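/- **Theorem (Normalization for $\lambda_{\mathrm G}$).** Let $t:A$ be a proof term of the parallel $\lambda$-calculus $\lambda_{\mathrm G}$, with arbitrary free variables. Then there is a proof term $t'$ with $t\mapsto^{*}t'$ (finitely many reduction steps) such that $t':A$, every free variable of $t'$ is a free variable of $t$, $t'$ is a parallel form, and $t'$ is normal (there is no $t''$ with $t'\mapsto t''$). Consequently $t'$ is a parallel composition of normal simply typed $\lambda$-terms, and, reading typed terms as deductions of the natural deduction calculus $\mathbf{NG}$ for Gödel logic, every $\mathbf{NG}$-deduction of $A$ reduces to a normal one of $A$ from at most the same open hypotheses. *Calculus.* Formulas are built from propositional variables and $\bot$ by $\wedge,\to$; $\top:=\bot\to\bot$. Terms, up to $\alpha$-equivalence, are typed as follows: variables $x^A:A$; $\lambda x^A u:A\to B$ if $u:B$; $tu:B$ if $t:A\to B$, $u:A$; $\langle u,t\rangle:A\wedge B$ if $u:A$, $t:B$; $u\,\pi_0:A$ and $u\,\pi_1:B$ if $u:A\wedge B$; $\mathsf{efq}_P(u):P$ if $u:\bot$, where $P$ is a propositional variable; and $u\parallel_a v:C$ if $u:C$ and $v:C$, where $a$, of type $A\to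 B$ in $u$ and of type $B\to A$ in $v$, becomes bound. The pair $A,B$, recorded in the operator, is the communication kind of $a$. A simply typed $\lambda$-term is a term without $\parallel$; parallel forms are the simply typed $\lambda$-terms and, recursively, the terms $u\parallel_a v$ with $u,v$ parallel forms. Write $\langle t_1,\dots,t_n\rangle=\langle t_1,\langle t_2,\dots\rangle\rangle$ and $A_1\wedge\dots\wedge A_n=A_1\wedge(A_2\wedge\dots)$; for $n=0$ these are $\lambda x^\bot x$ and $\top$. *Complexity.* A formula is prime if it is not a conjunction; every formula is a conjunction of prime formulas, its prime factors. A strong subformula of $A$ is a proper subformula of a prime proper subformula of $A$. If $u\parallel_a v:A$ has free variables of types $A_1,\dots,A_n$ and $a$ has kind $B,C$, the communication complexity of $a$ in it is the maximum of $0$ and the numbers of symbols of those prime factors of $B$ or $C$ that are neither proper subformulas of $A$ nor strong subformulas of some $A_i$. *Reductions.* $\mapsto$ is the closure under all contexts of the following rules, and $\mapsto^*$ is its reflexive transitive closure. 1. $(\lambda x\,u)t\mapsto u[t/x]$ and $\langle u_0,u_1\rangle\pi_i\mapsto u_i$. 2. With $a$ not free in $w$: $(u\parallel_a v)w\mapsto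 uw\parallel_a vw$; $w(u\parallel_a v)\mapsto wu\parallel_a wv$; $\langle u\parallel_a v,w\rangle\mapsto\langle u,w\rangle\parallel_a\langle v,w\rangle$; $\langle w,u\parallel_a v\rangle\mapsto\langle w,u\rangle\parallel_a\langle w,v\rangle$. Also $\mathsf{efq}_P(u\parallel_a v)\mapsto\mathsf{efq}_P(u)\parallel_a\mathsf{efq}_P(v)$; $(u\parallel_a v)\pi_i\mapsto u\pi_i\parallel_a v\pi_i$; $\lambda x(u\parallel_a v)\mapsto\lambda x\,u\parallel_a\lambda x\,v$. If the communication complexity of $b$ in the term on the left is positive (and $a$ is not free in $w$): $(u\parallel_a v)\parallel_b w\mapsto(u\parallel_b w)\parallel_a(v\parallel_b w)$ and $w\parallel_b(u\parallel_a v)\mapsto(w\parallel_b u)\parallel_a(w\parallel_b v)$. 3. $u\parallel_a v\mapsto u$ if $a$ does not occur in $u$; $u\parallel_a v\mapsto v$ if $a$ does not occur in $v$. 4. $\mathcal C[a\,u]\parallel_a\mathcal D[a\,v]\mapsto(\mathcal D[u^{b\langle\mathbf z\rangle/\mathbf y}]\parallel_a\mathcal C[a\,u])\parallel_b(\mathcal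 C[v^{b\langle\mathbf y\rangle/\mathbf z}]\parallel_a\mathcal D[a\,v])$, if the communication complexity of $a$ in the term on the left is positive, $\mathcal C[a\,u]$ and $\mathcal D[a\,v]$ are normal simply typed $\lambda$-terms, and the displayed occurrences of $a$ are the rightmost ones in them. Here $\mathcal C,\mathcal D$ are contexts with one hole, filled without renaming of bound variables; $\mathbf y$ (resp. $\mathbf z$) is the sequence of the free variables of $u$ bound in $\mathcal C[a\,u]$ (resp. of $v$ bound in $\mathcal D[a\,v]$), each listed once, from the innermost to the outermost binder; $b$ is fresh, its kind being the conjunction of the types of $\mathbf z$ and that of the types of $\mathbf y$; and $s^{w/\mathbf x}$ is the result of replacing each $x_i$ in $s$ by the projection of $w$ to the component of $x_i$. -/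

import Mathlib

namespace LambdaG

/-! ### Formulas -/

/-- Formulas of propositional Gödel logic over the primitive connectives `⊥`, `∧`, `→`
(disjunction is a defined connective, `¬ A` is `A → ⊥`). -/
inductive Form : Type where
  | bot : Form
  | atom : ℕ → Form
  | and : Form → Form → Form
  | imp : Form → Form → Form
  deriving DecidableEq

namespace Form

/-- `⊤` is shorthand for `⊥ → ⊥`. -/
def top : Form := imp bot bot

/-- The number of symbols (atoms, `⊥` and connectives) of a formula. -/
def symbols : Form → ℕ
  | bot => 1
  | atom _ => 1
  | and A B => A.symbols + B.symbols + 1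
  | imp A B => A.symbols + B.symbols + 1

/-- The subformulas of a formula, the formula itself included. -/
def subformulas : Form → Finset Form
  | bot => {bot}
  | atom n => {atom n}
  | and A B => insert (and A B) (A.subformulas ∪ B.subformulas)
  | imp A B => insert (imp A B) (A.subformulas ∪ B.subformulas)

/-- `B` is a proper subformula of `A`. -/
def ProperSubformula (B A : Form) : Prop := B ∈ A.subformulas ∧ B ≠ A

/-- A formula is prime if it is not a conjunction. -/
def IsPrime (A : Form) : Prop := ∀ B C : Form, A ≠ and B C

/-- The prime factors of a formula: the prime formulas of which it is a conjunction. -/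
def primeFactors : Form → Finset Form
  | bot => {bot}
  | atom n => {atom n}
  | and A B => A.primeFactors ∪ B.primeFactors
  | imp A B => {imp A B}

/-- `B` is a strong subformula of `A`: a proper subformula of some prime proper subformula
of `A`. -/
def StrongSubformula (B A : Form) : Prop :=
  ∃ P : Form, P.IsPrime ∧ ProperSubformula P A ∧ ProperSubformula B P

/-- `A₁ ∧ (A₂ ∧ … (Aₙ₋₁ ∧ Aₙ)…)`, and `⊤` for the empty sequence. -/
def conj : List Form → Form
  | [] => top
  | [A] => A
  | A :: B :: l => and A (conj (B :: l))

end Form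

/-! ### Proof terms

Terms are taken up to α-equivalence: variables are de Bruijn indices. -/

/-- Proof terms. `par A B u v` is the parallel composition `u ∥ₐ v` in which the communication
variable `a` has communication kind `A, B`: it is the variable `0` of `u`, where it has type
`A → B`, and the variable `0` of `v`, where it has type `B → A`.  `proj false`, `proj true` are
the projections `π₀`, `π₁`; `efq P u` is ex falso quodlibet with conclusion the atom `P`
(different from `⊥`). -/
inductive Tm : Type where
  | var : ℕ → Tm
  | lam : Form → Tm → Tm
  | app : Tm → Tm → Tm
  | pair : Tm → Tm → Tm
  | proj : Bool → Tm → Tm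
  | efq : ℕ → Tm → Tm
  | par : Form → Form → Tm → Tm → Tm

/-- The type assignment `Γ ⊢ t : A`; its derivations are the natural deductions of `NG`. The type
of the variable `n` is the `n`-th entry of `Γ`. -/
inductive HasType : List Form → Tm → Form → Prop where
  | var {Γ : List Form} {n : ℕ} {A : Form} :
      Γ[n]? = some A → HasType Γ (.var n) A
  | lam {Γ : List Form} {A B : Form} {u : Tm} :
      HasType (A :: Γ) u B → HasType Γ (.lam A u) (.imp A B)
  | app {Γ : List Form} {A B : Form} {t u : Tm} :
      HasType Γ t (.imp A B) → HasType Γ u A → HasType Γ (.app t u) B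
  | pair {Γ : List Form} {A B : Form} {u t : Tm} :
      HasType Γ u A → HasType Γ t B → HasType Γ (.pair u t) (.and A B)
  | proj₀ {Γ : List Form} {A B : Form} {u : Tm} :
      HasType Γ u (.and A B) → HasType Γ (.proj false u) A
  | proj₁ {Γ : List Form} {A B : Form} {u : Tm} :
      HasType Γ u (.and A B) → HasType Γ (.proj true u) B
  | efq {Γ : List Form} {P : ℕ} {u : Tm} :
      HasType Γ u .bot → HasType Γ (.efq P u) (.atom P)
  | par {Γ : List Form} {A B C : Form} {u v : Tm} :
      HasType (.imp A B :: Γ) u C → HasType (.imp B A :: Γ) v C → HasType Γ (.par A B u v) C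

/-- A renaming under one binder. -/
def liftRen (ρ : ℕ → ℕ) : ℕ → ℕ
  | 0 => 0
  | n + 1 => ρ n + 1

/-- The renaming that exchanges the two innermost variables. -/
def swapRen : ℕ → ℕ
  | 0 => 1
  | 1 => 0
  | n + 2 => n + 2

namespace Tm

/-- `occurs n t`: the variable `n` occurs free in `t`. -/
def occurs : ℕ → Tm → Bool
  | n, var m => n == m
  | n, lam _ u => occurs (n + 1) u
  | n, app t u => occurs n t || occurs n u
  | n, pair u t => occurs n u || occurs n t
  | n, proj _ u => occurs n u
  | n, efq _ u => occurs n u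
  | n, par _ _ u v => occurs (n + 1) u || occurs (n + 1) v

/-- Capture-avoiding renaming of the free variables. -/
def rename : (ℕ → ℕ) → Tm → Tm
  | ρ, var n => var (ρ n)
  | ρ, lam A u => lam A (rename (liftRen ρ) u)
  | ρ, app t u => app (rename ρ t) (rename ρ u)
  | ρ, pair u t => pair (rename ρ u) (rename ρ t)
  | ρ, proj i u => proj i (rename ρ u)
  | ρ, efq P u => efq P (rename ρ u)
  | ρ, par A B u v => par A B (rename (liftRen ρ) u) (rename (liftRen ρ) v)

/-- The term `t` seen in the scope of one further (innermost) variable, which does not occur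
in it. -/
def shift (t : Tm) : Tm := t.rename Nat.succ

/-- A substitution under one binder. -/
def liftSub (σ : ℕ → Tm) : ℕ → Tm
  | 0 => var 0
  | n + 1 => (σ n).shift

/-- Simultaneous capture-avoiding substitution for the free variables. -/
def subst : (ℕ → Tm) → Tm → Tm
  | σ, var n => σ n
  | σ, lam A u => lam A (subst (liftSub σ) u)
  | σ, app t u => app (subst σ t) (subst σ u)
  | σ, pair u t => pair (subst σ u) (subst σ t)
  | σ, proj i u => proj i (subst σ u)
  | σ, efq P u => efq P (subst σ u)
  | σ, par A B u v => par A B (subst (liftSub σ) u) (subst (liftSub σ) v)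

/-- `u[t/x]` where `x` is the innermost variable of `u`. -/
def inst (u t : Tm) : Tm :=
  u.subst fun n => match n with
    | 0 => t
    | m + 1 => var m

/-- `⟨t₁, ⟨t₂, … ⟨tₙ₋₁, tₙ⟩…⟩⟩`; the empty tuple is the term `λ x^⊥ x` of type `⊤`. -/
def tuple : List Tm → Tm
  | [] => lam .bot (var 0)
  | [t] => t
  | t :: s :: l => pair t (tuple (s :: l))

/-- `nthProj n i t` is the projection `t π₁ … π₁ π₀` (or `t π₁ … π₁` for the last component)
selecting the `i`-th component, counted from `0`, of a tuple `t` of `n` components. -/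
def nthProj : ℕ → ℕ → Tm → Tm
  | _ + 2, 0, t => proj false t
  | n + 2, i + 1, t => nthProj (n + 1) i (proj true t)
  | _, _, t => t

/-- A simply typed λ-term: the parallel operator does not occur in it. -/
def ParFree : Tm → Prop
  | var _ => True
  | lam _ u => ParFree u
  | app t u => ParFree t ∧ ParFree u
  | pair u t => ParFree u ∧ ParFree t
  | proj _ u => ParFree u
  | efq _ u => ParFree u
  | par _ _ _ _ => False

/-- Parallel forms: parallel compositions, bracketed in any way, of simply typed λ-terms. -/
inductive ParallelForm : Tm → Prop where
  | simple {t : Tm} : ParFree t → ParallelForm t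
  | par {A B : Form} {u v : Tm} :
      ParallelForm u → ParallelForm v → ParallelForm (par A B u v)

end Tm

/-! ### Simple contexts -/

/-- Contexts with exactly one hole and with no parallel operator above the hole. (They are only
used where the filled context is a simply typed λ-term, so that they are simple contexts.) -/
inductive Ctx : Type where
  | hole : Ctx
  | lam : Form → Ctx → Ctx
  | appL : Ctx → Tm → Ctx
  | appR : Tm → Ctx → Ctx
  | pairL : Ctx → Tm → Ctx
  | pairR : Tm → Ctx → Ctx
  | proj : Bool → Ctx → Ctx
  | efq : ℕ → Ctx → Ctx

namespace Ctx

/-- `𝒞[u]`, without renaming of bound variables: the free variables of `u` may be captured. -/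
def fill : Ctx → Tm → Tm
  | hole, u => u
  | lam A 𝒞, u => .lam A (𝒞.fill u)
  | appL 𝒞 t, u => .app (𝒞.fill u) t
  | appR t 𝒞, u => .app t (𝒞.fill u)
  | pairL 𝒞 t, u => .pair (𝒞.fill u) t
  | pairR t 𝒞, u => .pair t (𝒞.fill u)
  | proj i 𝒞, u => .proj i (𝒞.fill u)
  | efq P 𝒞, u => .efq P (𝒞.fill u)

/-- The types of the λ-variables bound at the hole, innermost first: at the hole, the variable
`i < 𝒞.binders.length` is the λ-variable whose type is the `i`-th entry. -/
def binders : Ctx → List Form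
  | hole => []
  | lam A 𝒞 => 𝒞.binders ++ [A]
  | appL 𝒞 _ => 𝒞.binders
  | appR _ 𝒞 => 𝒞.binders
  | pairL 𝒞 _ => 𝒞.binders
  | pairR _ 𝒞 => 𝒞.binders
  | proj _ 𝒞 => 𝒞.binders
  | efq _ 𝒞 => 𝒞.binders

/-- The number of λ-variables bound at the hole. -/
def depth (𝒞 : Ctx) : ℕ := 𝒞.binders.length

/-- Renaming of the variables that are free in the context. -/
def rename : (ℕ → ℕ) → Ctx → Ctx
  | _, hole => hole
  | ρ, lam A 𝒞 => lam A (rename (liftRen ρ) 𝒞)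
  | ρ, appL 𝒞 t => appL (rename ρ 𝒞) (t.rename ρ)
  | ρ, appR t 𝒞 => appR (t.rename ρ) (rename ρ 𝒞)
  | ρ, pairL 𝒞 t => pairL (rename ρ 𝒞) (t.rename ρ)
  | ρ, pairR t 𝒞 => pairR (t.rename ρ) (rename ρ 𝒞)
  | ρ, proj i 𝒞 => proj i (rename ρ 𝒞)
  | ρ, efq P 𝒞 => efq P (rename ρ 𝒞)

/-- The free variable `n` of the context occurs to the right of the hole. -/
def occursRight : ℕ → Ctx → Bool
  | _, hole => false
  | n, lam _ 𝒞 => occursRight (n + 1) 𝒞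
  | n, appL 𝒞 t => occursRight n 𝒞 || t.occurs n
  | n, appR _ 𝒞 => occursRight n 𝒞
  | n, pairL 𝒞 t => occursRight n 𝒞 || t.occurs n
  | n, pairR _ 𝒞 => occursRight n 𝒞
  | n, proj _ 𝒞 => occursRight n 𝒞
  | n, efq _ 𝒞 => occursRight n 𝒞

/-- The term `𝒞[a u]`, where `a` is the variable `0` outside of `𝒞`. -/
def fillComm (𝒞 : Ctx) (u : Tm) : Tm := 𝒞.fill (.app (.var 𝒞.depth) u)

/-- The displayed occurrence of `a` in `𝒞[a u]` is the rightmost one. -/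
def Rightmost (𝒞 : Ctx) (u : Tm) : Prop :=
  𝒞.occursRight 0 = false ∧ u.occurs 𝒞.depth = false

/-- The sequence of the free variables of `u` which are bound in `𝒞[a u]`, each one listed once,
with its type, from the innermost to the outermost. -/
def boundVars (𝒞 : Ctx) (u : Tm) : List (Form × ℕ) :=
  𝒞.binders.zipIdx.filter fun p => u.occurs p.2

end Ctx

/-- The conjunction of the types of a sequence of variables. -/
def conjTypes (y : List (Form × ℕ)) : Form := Form.conj (y.map Prod.fst)

/-- The tuple `⟨y⟩` of a sequence of variables. -/
def tupleVars (y : List (Form × ℕ)) : Tm := Tm.tuple (y.map fun p => Tm.var p.2)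

/-- The term `u^{b⟨z⟩/y}`, moved from the hole of a context binding `k` λ-variables (with the
communication variable `a`, index `k`, and then the outer variables outside of it) to the hole of
a context binding `m` λ-variables, with outside of it first `a`, index `m`, then the new
communication variable `b`, index `m + 1`, and then the same outer variables.
Each variable of the sequence `y` is replaced by the corresponding projection of `b⟨z⟩`; the outer
variables are kept, i.e. the index `k + 1 + j` becomes `m + 2 + j`. (In the use below no other
variable occurs in `u`.) -/
def migrate (k m : ℕ) (y z : List (Form × ℕ)) (u : Tm) : Tm :=
  u.subst fun i =>
    if i ∈ y.map Prod.snd then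
      Tm.nthProj y.length ((y.map Prod.snd).idxOf i) (.app (.var (m + 1)) (tupleVars z))
    else .var (i + m + 1 - k)

/-! ### Communication complexity -/

/-- `A` is the type, in `Γ`, of some free variable of `t`. -/
def IsFreeVarType (Γ : List Form) (t : Tm) (A : Form) : Prop :=
  ∃ n : ℕ, t.occurs n = true ∧ Γ[n]? = some A

open Classical in
/-- The communication complexity of `a` in `t = u ∥ₐ v : A`, where `B, C` is the communication
kind of `a`: the maximum among `0` and the numbers of symbols of the prime factors of `B` or `C`
that are neither proper subformulas of `A` nor strong subformulas of the type of some free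
variable of `t`. -/
noncomputable def commComplexity (Γ : List Form) (t : Tm) (A B C : Form) : ℕ :=
  ((B.primeFactors ∪ C.primeFactors).filter fun P =>
      ¬ P.ProperSubformula A ∧ ∀ D : Form, IsFreeVarType Γ t D → ¬ P.StrongSubformula D).sup
    Form.symbols

/-- In the scope `Γ`, the term `u ∥ₐ v`, with `B, C` the communication kind of `a`, is typed and
the communication complexity of `a` in it is greater than `0`. -/
def PosComm (Γ : List Form) (B C : Form) (u v : Tm) : Prop :=
  ∃ A : Form, HasType Γ (.par B C u v) A ∧ 0 < commComplexity Γ (.par B C u v) A B C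

/-! ### Reductions -/

/-- The closure of a relation under all contexts: `ℰ[t] ↦ ℰ[u]` whenever `t ↦ u`. The list records
the types of the variables in scope. -/
inductive Compat (R : List Form → Tm → Tm → Prop) : List Form → Tm → Tm → Prop where
  | base {Γ : List Form} {t t' : Tm} : R Γ t t' → Compat R Γ t t'
  | lam {Γ : List Form} {A : Form} {u u' : Tm} :
      Compat R (A :: Γ) u u' → Compat R Γ (.lam A u) (.lam A u')
  | appL {Γ : List Form} {t t' u : Tm} :
      Compat R Γ t t' → Compat R Γ (.app t u) (.app t' u)
  | appR {Γ : List Form} {t u u' : Tm} :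
      Compat R Γ u u' → Compat R Γ (.app t u) (.app t u')
  | pairL {Γ : List Form} {u u' t : Tm} :
      Compat R Γ u u' → Compat R Γ (.pair u t) (.pair u' t)
  | pairR {Γ : List Form} {u t t' : Tm} :
      Compat R Γ t t' → Compat R Γ (.pair u t) (.pair u t')
  | proj {Γ : List Form} {i : Bool} {u u' : Tm} :
      Compat R Γ u u' → Compat R Γ (.proj i u) (.proj i u')
  | efq {Γ : List Form} {P : ℕ} {u u' : Tm} :
      Compat R Γ u u' → Compat R Γ (.efq P u) (.efq P u')
  | parL {Γ : List Form} {A B : Form} {u u' v : Tm} :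
      Compat R (.imp A B :: Γ) u u' → Compat R Γ (.par A B u v) (.par A B u' v)
  | parR {Γ : List Form} {A B : Form} {u v v' : Tm} :
      Compat R (.imp B A :: Γ) v v' → Compat R Γ (.par A B u v) (.par A B u v')

/-- Intuitionistic reductions. -/
inductive Intuitionistic : Tm → Tm → Prop where
  | beta (A : Form) (u t : Tm) : Intuitionistic (.app (.lam A u) t) (u.inst t)
  | proj₀ (u₀ u₁ : Tm) : Intuitionistic (.proj false (.pair u₀ u₁)) u₀
  | proj₁ (u₀ u₁ : Tm) : Intuitionistic (.proj true (.pair u₀ u₁)) u₁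

/-- Permutation reductions. Terms that enter the scope of a communication variable are shifted,
hence that variable does not occur in them; where two binders are exchanged, so are the variables
that they bind. -/
inductive Permutation : List Form → Tm → Tm → Prop where
  | appL (Γ : List Form) (A B : Form) (u v w : Tm) :
      Permutation Γ (.app (.par A B u v) w) (.par A B (.app u w.shift) (.app v w.shift))
  | appR (Γ : List Form) (A B : Form) (u v w : Tm) :
      Permutation Γ (.app w (.par A B u v)) (.par A B (.app w.shift u) (.app w.shift v))
  | efq (Γ : List Form) (A B : Form) (P : ℕ) (u v : Tm) :
      Permutation Γ (.efq P (.par A B u v)) (.par A B (.efq P u) (.efq P v))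
  | proj (Γ : List Form) (A B : Form) (i : Bool) (u v : Tm) :
      Permutation Γ (.proj i (.par A B u v)) (.par A B (.proj i u) (.proj i v))
  | lam (Γ : List Form) (A B C : Form) (u v : Tm) :
      Permutation Γ (.lam C (.par A B u v))
        (.par A B (.lam C (u.rename swapRen)) (.lam C (v.rename swapRen)))
  | pairL (Γ : List Form) (A B : Form) (u v w : Tm) :
      Permutation Γ (.pair (.par A B u v) w) (.par A B (.pair u w.shift) (.pair v w.shift))
  | pairR (Γ : List Form) (A B : Form) (u v w : Tm) :
      Permutation Γ (.pair w (.par A B u v)) (.par A B (.pair w.shift u) (.pair w.shift v))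
  | parL (Γ : List Form) (A B C D : Form) (u v w : Tm) :
      PosComm Γ C D (.par A B u v) w →
      Permutation Γ (.par C D (.par A B u v) w)
        (.par A B (.par C D (u.rename swapRen) (w.rename (liftRen Nat.succ)))
          (.par C D (v.rename swapRen) (w.rename (liftRen Nat.succ))))
  | parR (Γ : List Form) (A B C D : Form) (u v w : Tm) :
      PosComm Γ C D w (.par A B u v) →
      Permutation Γ (.par C D w (.par A B u v))
        (.par A B (.par C D (w.rename (liftRen Nat.succ)) (u.rename swapRen))
          (.par C D (w.rename (liftRen Nat.succ)) (v.rename swapRen)))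

/-- A term without intuitionistic redexes (the list of types plays no role here). For simply typed
λ-terms this is normality, see `intNormal_iff_isNormal` below. -/
def IntNormal (t : Tm) : Prop :=
  ∀ t' : Tm, ¬ Compat (fun _ => Intuitionistic) [] t t'

/-- Cross reductions. The terms `u.shift`, `v.shift` are those in which the communication variable
does not occur. In `cross`, `b` is the variable bound by the outermost parallel operator of the
result, which has kind `conjTypes z`, `conjTypes y`; inside of it, in the scope of `a`, the
renaming `liftRen Nat.succ` keeps `a` and makes room for `b`. -/
inductive Cross : List Form → Tm → Tm → Prop where
  | left (Γ : List Form) (A B : Form) (u v : Tm) : Cross Γ (.par A B u.shift v) u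
  | right (Γ : List Form) (A B : Form) (u v : Tm) : Cross Γ (.par A B u v.shift) v
  | cross (Γ : List Form) (A B : Form) (𝒞 𝒟 : Ctx) (u v : Tm) (y z : List (Form × ℕ)) :
      (𝒞.fillComm u).ParFree → IntNormal (𝒞.fillComm u) →
      (𝒟.fillComm v).ParFree → IntNormal (𝒟.fillComm v) →
      𝒞.Rightmost u → 𝒟.Rightmost v →
      y = 𝒞.boundVars u → z = 𝒟.boundVars v →
      PosComm Γ A B (𝒞.fillComm u) (𝒟.fillComm v) →
      Cross Γ (.par A B (𝒞.fillComm u) (𝒟.fillComm v))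
        (.par (conjTypes z) (conjTypes y)
          (.par B A
            ((𝒟.rename (liftRen Nat.succ)).fill (migrate 𝒞.depth 𝒟.depth y z u))
            ((𝒞.fillComm u).rename (liftRen Nat.succ)))
          (.par A B
            ((𝒞.rename (liftRen Nat.succ)).fill (migrate 𝒟.depth 𝒞.depth z y v))
            ((𝒟.fillComm v).rename (liftRen Nat.succ))))

/-- The basic reductions. -/
inductive Basic : List Form → Tm → Tm → Prop where
  | int {Γ : List Form} {t t' : Tm} : Intuitionistic t t' → Basic Γ t t'
  | perm {Γ : List Form} {t t' : Tm} : Permutation Γ t t' → Basic Γ t t'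
  | cross {Γ : List Form} {t t' : Tm} : Cross Γ t t' → Basic Γ t t'

/-- One-step reduction `t ↦ t'` of terms whose free variables have the types listed in `Γ`. -/
def Step : List Form → Tm → Tm → Prop := Compat Basic

/-- Normal forms. -/
def IsNormal (Γ : List Form) (t : Tm) : Prop := ∀ t' : Tm, ¬ Step Γ t t'

/-- For simply typed λ-terms, having no intuitionistic redex is the same as being normal. -/
theorem intNormal_iff_isNormal {t : Tm} (h : t.ParFree) (Γ : List Form) :
    IntNormal t ↔ IsNormal Γ t := by
  have key₁ : ∀ {Γ : List Form} {t t' : Tm}, Step Γ t t' → t.ParFree →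
      ∀ Δ : List Form, Compat (fun _ => Intuitionistic) Δ t t' := by
    intro Γ t t' hs
    unfold Step at hs
    induction hs with
    | base hb =>
      intro h Δ
      cases hb with
      | int h' => exact .base h'
      | perm h' => cases h' <;> simp [Tm.ParFree] at h
      | cross h' => cases h' <;> simp [Tm.ParFree] at h
    | lam _ ih => exact fun h Δ => .lam (ih h _)
    | appL _ ih => exact fun h Δ => .appL (ih h.1 _)
    | appR _ ih => exact fun h Δ => .appR (ih h.2 _)
    | pairL _ ih => exact fun h Δ => .pairL (ih h.1 _)
    | pairR _ ih => exact fun h Δ => .pairR (ih h.2 _)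
    | proj _ ih => exact fun h Δ => .proj (ih h _)
    | efq _ ih => exact fun h Δ => .efq (ih h _)
    | parL _ _ => exact fun h => h.elim
    | parR _ _ => exact fun h => h.elim
  have key₂ : ∀ {Γ : List Form} {t t' : Tm}, Compat (fun _ => Intuitionistic) Γ t t' →
      ∀ Δ : List Form, Step Δ t t' := by
    intro Γ t t' hs
    unfold Step
    induction hs with
    | base hb => exact fun Δ => .base (.int hb)
    | lam _ ih => exact fun Δ => .lam (ih _)
    | appL _ ih => exact fun Δ => .appL (ih _)
    | appR _ ih => exact fun Δ => .appR (ih _)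
    | pairL _ ih => exact fun Δ => .pairL (ih _)
    | pairR _ ih => exact fun Δ => .pairR (ih _)
    | proj _ ih => exact fun Δ => .proj (ih _)
    | efq _ ih => exact fun Δ => .efq (ih _)
    | parL _ ih => exact fun Δ => .parL (ih _)
    | parR _ ih => exact fun Δ => .parR (ih _)
  exact ⟨fun H t' hs => H t' (key₁ hs h []), fun H t' hs => H t' (key₂ hs Γ)⟩

end LambdaG

/-!
Permutations bring every term to a parallel form, and cross reductions on parallel forms are
controlled by sets `E` of formulas, closed under subformulas, which contain the proper subformulas
of `A` and the strong subformulas of the types of the free variables.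

*Lowering the kinds.* All communication kinds can be made conjunctions of elements of `E`. A kind
which is not has positive complexity, so that permutations and cross reductions apply to it. When
`u` and `v` are normal and simply typed, the subformula property puts the types of the variables
bound in them into `E`, provided the proper subformulas of the prime factors of the kind are in `E`;
so the kind of the variable `b` introduced by a cross reduction is a conjunction of elements of `E`.
The old variable `a` loses its rightmost occurrence on each side, and regains none when the result
is normalized, so the process stops. The proviso is met by treating kinds in order of decreasing
size: let `E` contain all formulas with fewer than `c` symbols as well, and decrease `c`.

*Shrinking `E`.* Start from a finite `E`. When all kinds are conjunctions of elements of `E`,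
normalize the simply typed components and drop the compositions whose variable is missing on one
side. If some complexity is still positive, a prime factor which witnesses this can be removed from
`E`, and the kinds are lowered again. Otherwise the term is normal.
-/

namespace LambdaG

open Relation

/-! ### Renaming and substitution -/

theorem liftRen_id : liftRen id = id := by
  funext n; cases n <;> rfl

theorem liftRen_comp (ρ ρ' : ℕ → ℕ) : liftRen (ρ' ∘ ρ) = liftRen ρ' ∘ liftRen ρ := by
  funext n; cases n <;> rfl

theorem liftRen_congr {p : ℕ → Prop} {ρ ρ' : ℕ → ℕ} (h : ∀ n, p (n + 1) → ρ n = ρ' n) :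
    ∀ n, p n → liftRen ρ n = liftRen ρ' n
  | 0, _ => rfl
  | n + 1, hn => congrArg (· + 1) (h n hn)

theorem liftRen_eq_zero {ρ : ℕ → ℕ} {n : ℕ} : liftRen ρ n = 0 ↔ n = 0 := by
  cases n <;> simp [liftRen]

theorem exists_liftRen_eq_succ {p : ℕ → Prop} {ρ : ℕ → ℕ} {n : ℕ} :
    (∃ m, p m ∧ liftRen ρ m = n + 1) ↔ ∃ m, p (m + 1) ∧ ρ m = n := by
  rw [← Nat.or_exists_add_one]
  simp [liftRen]

namespace Tm

theorem rename_congr {t : Tm} {ρ ρ' : ℕ → ℕ} (h : ∀ n, t.occurs n → ρ n = ρ' n) :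
    t.rename ρ = t.rename ρ' := by
  induction t generalizing ρ ρ' with
  | var m => exact congrArg var (h m (by simp [occurs]))
  | lam A u ih => exact congrArg (lam A) (ih (liftRen_congr h))
  | app t u iht ihu | pair t u iht ihu =>
    simp only [occurs, Bool.or_eq_true, or_imp, forall_and] at h
    simp only [rename, iht h.1, ihu h.2]
  | proj i u ih | efq i u ih => exact congrArg _ (ih h)
  | par A B u v ihu ihv =>
    simp only [occurs, Bool.or_eq_true, or_imp, forall_and] at h
    simp only [rename, ihu (liftRen_congr h.1), ihv (liftRen_congr h.2)]

theorem rename_id (t : Tm) : t.rename id = t := by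
  induction t <;> simp_all [rename, liftRen_id]

theorem rename_rename (t : Tm) (ρ ρ' : ℕ → ℕ) : (t.rename ρ).rename ρ' = t.rename (ρ' ∘ ρ) := by
  induction t generalizing ρ ρ' <;> simp_all [rename, liftRen_comp]

theorem occurs_rename {t : Tm} {ρ : ℕ → ℕ} {n : ℕ} :
    (t.rename ρ).occurs n ↔ ∃ m, t.occurs m ∧ ρ m = n := by
  induction t generalizing ρ n with
  | var m => simpa [rename, occurs] using eq_comm
  | _ => simp_all [rename, occurs, exists_liftRen_eq_succ, or_and_right, exists_or]

theorem occurs_shift_zero (t : Tm) : t.shift.occurs 0 = false := by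
  rw [← Bool.not_eq_true, shift, occurs_rename]
  simp

theorem occurs_shift_succ (t : Tm) (n : ℕ) : t.shift.occurs (n + 1) = t.occurs n := by
  rw [Bool.eq_iff_iff, shift, occurs_rename]
  simp

theorem exists_eq_shift {t : Tm} (h : t.occurs 0 = false) : ∃ s : Tm, t = s.shift := by
  refine ⟨t.rename Nat.pred, ?_⟩
  rw [shift, rename_rename]
  conv_lhs => rw [← rename_id t]
  refine rename_congr fun n hn => ?_
  cases n with
  | zero => simp [h] at hn
  | succ n => rfl

theorem parFree_rename {t : Tm} {ρ : ℕ → ℕ} : (t.rename ρ).ParFree ↔ t.ParFree := by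
  induction t generalizing ρ <;> simp_all [rename, ParFree]

theorem liftSub_var : liftSub var = var := by
  funext n; cases n <;> rfl

theorem liftSub_comp_liftRen (σ : ℕ → Tm) (ρ : ℕ → ℕ) :
    liftSub σ ∘ liftRen ρ = liftSub (σ ∘ ρ) := by
  funext n; cases n <;> rfl

theorem subst_var (t : Tm) : t.subst var = t := by
  induction t <;> simp_all [subst, liftSub_var]

theorem subst_rename (t : Tm) (ρ : ℕ → ℕ) (σ : ℕ → Tm) :
    (t.rename ρ).subst σ = t.subst (σ ∘ ρ) := by
  induction t generalizing ρ σ <;> simp_all [rename, subst, liftSub_comp_liftRen]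

theorem rename_liftSub (σ : ℕ → Tm) (ρ : ℕ → ℕ) :
    (fun n => (liftSub σ n).rename (liftRen ρ)) = liftSub fun n => (σ n).rename ρ := by
  funext n
  cases n with
  | zero => rfl
  | succ n => simp only [liftSub, shift, rename_rename]; rfl

theorem rename_subst (t : Tm) (σ : ℕ → Tm) (ρ : ℕ → ℕ) :
    (t.subst σ).rename ρ = t.subst fun n => (σ n).rename ρ := by
  induction t generalizing σ ρ <;> simp_all [rename, subst, rename_liftSub]

theorem subst_liftSub (σ τ : ℕ → Tm) :
    (fun n => (liftSub σ n).subst (liftSub τ)) = liftSub fun n => (σ n).subst τ := by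
  funext n
  cases n with
  | zero => rfl
  | succ n => simp only [liftSub, shift, subst_rename, rename_subst]; rfl

theorem subst_subst (t : Tm) (σ τ : ℕ → Tm) :
    (t.subst σ).subst τ = t.subst fun n => (σ n).subst τ := by
  induction t generalizing σ τ <;> simp_all [subst, subst_liftSub]

theorem exists_occurs_liftSub {p : ℕ → Prop} {σ : ℕ → Tm} {n : ℕ} :
    (∃ m, p m ∧ (liftSub σ m).occurs (n + 1)) ↔ ∃ m, p (m + 1) ∧ (σ m).occurs n := by
  rw [← Nat.or_exists_add_one]
  simp [liftSub, occurs, occurs_shift_succ]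

theorem occurs_subst {t : Tm} {σ : ℕ → Tm} {n : ℕ} :
    (t.subst σ).occurs n ↔ ∃ m, t.occurs m ∧ (σ m).occurs n := by
  induction t generalizing σ n with
  | var m => simp [subst, occurs]
  | _ => simp_all [subst, occurs, exists_occurs_liftSub, or_and_right, exists_or]

theorem parFree_subst {t : Tm} {σ : ℕ → Tm} (h : t.ParFree) (hσ : ∀ n, (σ n).ParFree) :
    (t.subst σ).ParFree := by
  induction t generalizing σ with
  | var n => exact hσ n
  | lam A u ih =>
    refine ih (σ := liftSub σ) h fun n => ?_
    cases n with
    | zero => trivial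
    | succ n => exact parFree_rename.2 (hσ n)
  | app t u iht ihu | pair t u iht ihu => exact ⟨iht h.1 hσ, ihu h.2 hσ⟩
  | proj i u ih | efq i u ih => exact ih h hσ
  | par => exact h.elim

/-- The substitution by which `Tm.inst` is defined: `t` for the innermost variable. -/
def single (t : Tm) : ℕ → Tm
  | 0 => t
  | m + 1 => var m

theorem inst_eq_subst_single (u t : Tm) : u.inst t = u.subst (single t) := by
  unfold inst; congr 1

theorem rename_inst (u t : Tm) (ρ : ℕ → ℕ) :
    (u.inst t).rename ρ = (u.rename (liftRen ρ)).inst (t.rename ρ) := by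
  rw [inst_eq_subst_single, inst_eq_subst_single, rename_subst, subst_rename]
  congr 1; funext n; cases n <;> rfl

theorem inst_rename_subst_liftSub (u t : Tm) (σ : ℕ → Tm) (ρ : ℕ → ℕ) :
    ((u.subst (liftSub σ)).rename (liftRen ρ)).inst t =
      u.subst fun | 0 => t | n + 1 => (σ n).rename ρ := by
  rw [inst_eq_subst_single, subst_rename, subst_subst]
  congr 1
  funext n
  cases n with
  | zero => rfl
  | succ n =>
    simp only [liftSub, shift, subst_rename]
    rw [← subst_var ((σ n).rename ρ), subst_rename]
    rfl

theorem occurs_inst {u t : Tm} {n : ℕ} (h : (u.inst t).occurs n) :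
    u.occurs (n + 1) ∨ t.occurs n := by
  rw [inst_eq_subst_single, occurs_subst, ← Nat.or_exists_add_one] at h
  simp only [single, occurs, beq_iff_eq, exists_eq_right'] at h
  exact h.symm.imp_right And.right

end Tm

/-! ### Typing -/

section Inversion

variable {Γ : List Form} {A B C : Form} {t u v : Tm}

theorem hasType_var_iff {n : ℕ} : HasType Γ (.var n) A ↔ Γ[n]? = some A :=
  ⟨fun | .var h => h, .var⟩

theorem hasType_lam_iff : HasType Γ (.lam A u) C ↔ ∃ B, HasType (A :: Γ) u B ∧ C = .imp A B :=
  ⟨fun | .lam h => ⟨_, h, rfl⟩, fun ⟨_, h, e⟩ => e ▸ .lam h⟩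

theorem hasType_app_iff : HasType Γ (.app t u) B ↔ ∃ A, HasType Γ t (.imp A B) ∧ HasType Γ u A :=
  ⟨fun | .app ht hu => ⟨_, ht, hu⟩, fun ⟨_, ht, hu⟩ => .app ht hu⟩

theorem hasType_pair_iff :
    HasType Γ (.pair t u) C ↔ ∃ A B, (HasType Γ t A ∧ HasType Γ u B) ∧ C = .and A B :=
  ⟨fun | .pair ht hu => ⟨_, _, ⟨ht, hu⟩, rfl⟩, fun ⟨_, _, ⟨ht, hu⟩, e⟩ => e ▸ .pair ht hu⟩

theorem hasType_proj_iff {i : Bool} :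
    HasType Γ (.proj i u) C ↔ ∃ A B, HasType Γ u (.and A B) ∧ C = bif i then B else A := by
  refine ⟨fun | .proj₀ h => ⟨_, _, h, rfl⟩ | .proj₁ h => ⟨_, _, h, rfl⟩, ?_⟩
  rintro ⟨A, B, h, rfl⟩
  cases i with
  | false => exact .proj₀ h
  | true => exact .proj₁ h

theorem hasType_efq_iff {P : ℕ} : HasType Γ (.efq P u) A ↔ HasType Γ u .bot ∧ A = .atom P :=
  ⟨fun | .efq h => ⟨h, rfl⟩, fun ⟨h, e⟩ => e ▸ .efq h⟩

theorem hasType_par_iff :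
    HasType Γ (.par A B u v) C ↔ HasType (.imp A B :: Γ) u C ∧ HasType (.imp B A :: Γ) v C :=
  ⟨fun | .par hu hv => ⟨hu, hv⟩, fun ⟨hu, hv⟩ => .par hu hv⟩

end Inversion

theorem HasType.unique {Γ : List Form} {t : Tm} {A B : Form} (h : HasType Γ t A)
    (h' : HasType Γ t B) : A = B := by
  induction h generalizing B with
  | var e => exact Option.some.inj (e.symm.trans (hasType_var_iff.1 h'))
  | lam _ ih => cases h' with | lam h' => rw [ih h']
  | app _ _ ih _ => cases h' with | app h' _ => exact (Form.imp.inj (ih h')).2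
  | pair _ _ ih₁ ih₂ => cases h' with | pair h₁ h₂ => rw [ih₁ h₁, ih₂ h₂]
  | proj₀ _ ih => cases h' with | proj₀ h' => exact (Form.and.inj (ih h')).1
  | proj₁ _ ih => cases h' with | proj₁ h' => exact (Form.and.inj (ih h')).2
  | efq _ _ => exact (hasType_efq_iff.1 h').2.symm
  | par _ _ ih _ => exact ih (hasType_par_iff.1 h').1

theorem getElem?_cons_liftRen {Γ Δ : List Form} {ρ : ℕ → ℕ} {p : ℕ → Prop}
    (h : ∀ n, p (n + 1) → Δ[ρ n]? = Γ[n]?) (A : Form) :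
    ∀ n, p n → (A :: Δ)[liftRen ρ n]? = (A :: Γ)[n]?
  | 0, _ => rfl
  | n + 1, hn => by simpa [liftRen] using h n hn

theorem hasType_rename_iff {t : Tm} {Γ Δ : List Form} {ρ : ℕ → ℕ} {A : Form}
    (h : ∀ n, t.occurs n → Δ[ρ n]? = Γ[n]?) : HasType Δ (t.rename ρ) A ↔ HasType Γ t A := by
  induction t generalizing Γ Δ ρ A with
  | var m => rw [Tm.rename, hasType_var_iff, hasType_var_iff, h m (by simp [Tm.occurs])]
  | lam B u ih => simp only [Tm.rename, hasType_lam_iff, ih (getElem?_cons_liftRen h B)]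
  | app t u iht ihu | pair t u iht ihu =>
    simp only [Tm.occurs, Bool.or_eq_true, or_imp, forall_and] at h
    simp only [Tm.rename, hasType_app_iff, hasType_pair_iff, iht h.1, ihu h.2]
  | proj i u ih | efq P u ih =>
    simp only [Tm.rename, hasType_proj_iff, hasType_efq_iff, ih h]
  | par B C u v ihu ihv =>
    simp only [Tm.occurs, Bool.or_eq_true, or_imp, forall_and] at h
    simp only [Tm.rename, hasType_par_iff, ihu (getElem?_cons_liftRen h.1 _),
      ihv (getElem?_cons_liftRen h.2 _)]

theorem hasType_shift_iff {Γ : List Form} {t : Tm} {A B : Form} :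
    HasType (B :: Γ) t.shift A ↔ HasType Γ t A :=
  hasType_rename_iff fun n _ => by simp

theorem hasType_rename_swapRen_iff {Γ : List Form} {t : Tm} {A B C : Form} :
    HasType (C :: B :: Γ) (t.rename swapRen) A ↔ HasType (B :: C :: Γ) t A :=
  hasType_rename_iff fun | 0, _ | 1, _ | _ + 2, _ => by simp [swapRen]

theorem hasType_rename_liftRen_succ_iff {Γ : List Form} {t : Tm} {A B C : Form} :
    HasType (B :: C :: Γ) (t.rename (liftRen Nat.succ)) A ↔ HasType (B :: Γ) t A :=
  hasType_rename_iff fun | 0, _ | _ + 1, _ => by simp [liftRen]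

theorem HasType.liftSub {p : ℕ → Prop} {Γ Δ : List Form} {σ : ℕ → Tm}
    (h : ∀ n F, p (n + 1) → Γ[n]? = some F → HasType Δ (σ n) F) (B : Form) :
    ∀ n F, p n → (B :: Γ)[n]? = some F → HasType (B :: Δ) (Tm.liftSub σ n) F
  | 0, _, _, e => .var e
  | n + 1, F, hn, e => hasType_shift_iff.2 (h n F hn e)

theorem HasType.subst {t : Tm} {Γ Δ : List Form} {σ : ℕ → Tm} {A : Form} (ht : HasType Γ t A)
    (h : ∀ n F, t.occurs n → Γ[n]? = some F → HasType Δ (σ n) F) : HasType Δ (t.subst σ) A := by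
  induction ht generalizing Δ σ with
  | @var _ n _ e => exact h n _ (by simp [Tm.occurs]) e
  | lam _ ih => exact .lam (ih (liftSub h _))
  | app _ _ iht ihu =>
    simp only [Tm.occurs, Bool.or_eq_true, or_imp, forall_and] at h
    exact .app (iht h.1) (ihu h.2)
  | pair _ _ iht ihu =>
    simp only [Tm.occurs, Bool.or_eq_true, or_imp, forall_and] at h
    exact .pair (iht h.1) (ihu h.2)
  | proj₀ _ ih => exact .proj₀ (ih h)
  | proj₁ _ ih => exact .proj₁ (ih h)
  | efq _ ih => exact .efq (ih h)
  | par _ _ ihu ihv =>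
    simp only [Tm.occurs, Bool.or_eq_true, or_imp, forall_and] at h
    exact .par (ihu (liftSub h.1 _)) (ihv (liftSub h.2 _))

theorem HasType.inst {Γ : List Form} {u t : Tm} {A B : Form} (hu : HasType (A :: Γ) u B)
    (ht : HasType Γ t A) : HasType Γ (u.inst t) B := by
  rw [Tm.inst_eq_subst_single]
  refine hu.subst fun n F _ e => ?_
  cases n with
  | zero => exact Option.some.inj e ▸ ht
  | succ n => exact .var e

/-! ### Contexts -/

theorem iterate_liftRen (k : ℕ) (ρ : ℕ → ℕ) (n : ℕ) :
    liftRen^[k] ρ n = if n < k then n else ρ (n - k) + k := by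
  induction k generalizing n with
  | zero => simp
  | succ k ih =>
    rw [Function.iterate_succ_apply']
    cases n with
    | zero => simp [liftRen]
    | succ n =>
      simp only [liftRen, ih, Nat.add_lt_add_iff_right, Nat.add_sub_add_right]
      split <;> rfl

namespace Ctx

theorem depth_lam (A : Form) (𝒞 : Ctx) : (lam A 𝒞).depth = 𝒞.depth + 1 := by
  simp [depth, binders]

/-- `𝒞.occurs n`: the variable `n`, counted outside of `𝒞`, occurs free in the context. -/
def occurs : ℕ → Ctx → Bool
  | _, hole => false
  | n, lam _ 𝒞 => occurs (n + 1) 𝒞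
  | n, appL 𝒞 t => occurs n 𝒞 || t.occurs n
  | n, appR t 𝒞 => t.occurs n || occurs n 𝒞
  | n, pairL 𝒞 t => occurs n 𝒞 || t.occurs n
  | n, pairR t 𝒞 => t.occurs n || occurs n 𝒞
  | n, proj _ 𝒞 => occurs n 𝒞
  | n, efq _ 𝒞 => occurs n 𝒞

theorem occurs_fill {𝒞 : Ctx} {s : Tm} {n : ℕ} :
    (𝒞.fill s).occurs n ↔ 𝒞.occurs n ∨ s.occurs (𝒞.depth + n) := by
  induction 𝒞 generalizing n with
  | hole => simp [fill, occurs, depth, binders]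
  | lam A 𝒞 ih => rw [depth_lam, Nat.add_right_comm]; exact ih
  | appL 𝒞 t ih | pairL 𝒞 t ih =>
    simp only [fill, occurs, Tm.occurs, Bool.or_eq_true, ih, depth, binders]
    exact or_right_comm
  | appR t 𝒞 ih | pairR t 𝒞 ih =>
    simp only [fill, occurs, Tm.occurs, Bool.or_eq_true, ih, depth, binders]
    exact or_assoc.symm
  | proj _ _ ih | efq _ _ ih => exact ih

theorem occurs_fillComm {𝒞 : Ctx} {u : Tm} {n : ℕ} :
    (𝒞.fillComm u).occurs (n + 1) ↔ 𝒞.occurs (n + 1) ∨ u.occurs (𝒞.depth + (n + 1)) := by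
  simp [fillComm, occurs_fill, Tm.occurs]

theorem binders_rename (𝒞 : Ctx) (ρ : ℕ → ℕ) : (𝒞.rename ρ).binders = 𝒞.binders := by
  induction 𝒞 generalizing ρ <;> simp_all [rename, binders]

theorem depth_rename (𝒞 : Ctx) (ρ : ℕ → ℕ) : (𝒞.rename ρ).depth = 𝒞.depth := by
  rw [depth, binders_rename, depth]

theorem occurs_rename {𝒞 : Ctx} {ρ : ℕ → ℕ} {n : ℕ} :
    (𝒞.rename ρ).occurs n ↔ ∃ m, 𝒞.occurs m ∧ ρ m = n := by
  induction 𝒞 generalizing ρ n <;>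
    simp_all [rename, occurs, Tm.occurs_rename, exists_liftRen_eq_succ, or_and_right, exists_or]

theorem rename_fill (𝒞 : Ctx) (s : Tm) (ρ : ℕ → ℕ) :
    (𝒞.fill s).rename ρ = (𝒞.rename ρ).fill (s.rename (liftRen^[𝒞.depth] ρ)) := by
  induction 𝒞 generalizing ρ with
  | hole => rfl
  | lam A 𝒞 ih => rw [depth_lam, Function.iterate_succ_apply]; exact congrArg (Tm.lam A) (ih _)
  | appL 𝒞 t ih | appR t 𝒞 ih | pairL 𝒞 t ih | pairR t 𝒞 ih | proj i 𝒞 ih | efq i 𝒞 ih =>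
    simp only [rename, fill, Tm.rename, ih]; rfl

/-- The typing of contexts: in the scope `Γ`, filling `𝒞` with a term of type `F` yields a term of
type `A`. -/
def Typed : Ctx → List Form → Form → Form → Prop
  | hole, _, F, A => F = A
  | lam B 𝒞, Γ, F, A => ∃ C, 𝒞.Typed (B :: Γ) F C ∧ A = .imp B C
  | appL 𝒞 t, Γ, F, A => ∃ B, 𝒞.Typed Γ F (.imp B A) ∧ HasType Γ t B
  | appR t 𝒞, Γ, F, A => ∃ B, HasType Γ t (.imp B A) ∧ 𝒞.Typed Γ F B
  | pairL 𝒞 t, Γ, F, A => ∃ B C, (𝒞.Typed Γ F B ∧ HasType Γ t C) ∧ A = .and B C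
  | pairR t 𝒞, Γ, F, A => ∃ B C, (HasType Γ t B ∧ 𝒞.Typed Γ F C) ∧ A = .and B C
  | proj i 𝒞, Γ, F, A => ∃ B C, 𝒞.Typed Γ F (.and B C) ∧ A = bif i then C else B
  | efq P 𝒞, Γ, F, A => 𝒞.Typed Γ F .bot ∧ A = .atom P

theorem hasType_fill_iff {𝒞 : Ctx} {s : Tm} {Γ : List Form} {A : Form} :
    HasType Γ (𝒞.fill s) A ↔ ∃ F, 𝒞.Typed Γ F A ∧ HasType (𝒞.binders ++ Γ) s F := by
  induction 𝒞 generalizing Γ A with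
  | hole => simp [fill, Typed, binders]
  | _ =>
    simp_all only [fill, Typed, binders, hasType_lam_iff, hasType_app_iff, hasType_pair_iff,
      hasType_proj_iff, hasType_efq_iff, List.append_assoc, List.singleton_append]
    grind

theorem Typed.rename {𝒞 : Ctx} {Γ Δ : List Form} {ρ : ℕ → ℕ} {F A : Form}
    (h𝒞 : 𝒞.Typed Γ F A) (h : ∀ n, 𝒞.occurs n → Δ[ρ n]? = Γ[n]?) :
    (𝒞.rename ρ).Typed Δ F A := by
  induction 𝒞 generalizing Γ Δ ρ A with
  | hole => exact h𝒞
  | lam B 𝒞 ih =>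
    obtain ⟨C, h𝒞, rfl⟩ := h𝒞
    exact ⟨C, ih h𝒞 (getElem?_cons_liftRen h B), rfl⟩
  | appL 𝒞 t ih =>
    simp only [occurs, Bool.or_eq_true, or_imp, forall_and] at h
    exact h𝒞.imp fun B => .imp (ih · h.1) (hasType_rename_iff h.2).2
  | appR t 𝒞 ih =>
    simp only [occurs, Bool.or_eq_true, or_imp, forall_and] at h
    exact h𝒞.imp fun B => .imp (hasType_rename_iff h.1).2 (ih · h.2)
  | pairL 𝒞 t ih =>
    simp only [occurs, Bool.or_eq_true, or_imp, forall_and] at h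
    obtain ⟨B, C, ⟨h𝒞, ht⟩, rfl⟩ := h𝒞
    exact ⟨B, C, ⟨ih h𝒞 h.1, (hasType_rename_iff h.2).2 ht⟩, rfl⟩
  | pairR t 𝒞 ih =>
    simp only [occurs, Bool.or_eq_true, or_imp, forall_and] at h
    obtain ⟨B, C, ⟨ht, h𝒞⟩, rfl⟩ := h𝒞
    exact ⟨B, C, ⟨(hasType_rename_iff h.1).2 ht, ih h𝒞 h.2⟩, rfl⟩
  | proj i 𝒞 ih => exact h𝒞.imp fun B => .imp fun C => .imp_left (ih · h)
  | efq P 𝒞 ih => exact h𝒞.imp_left (ih · h)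

theorem getElem?_binders_append (𝒞 : Ctx) (Γ : List Form) (n : ℕ) :
    (𝒞.binders ++ Γ)[𝒞.depth + n]? = Γ[n]? := by
  simp [depth, List.getElem?_append_right]

theorem mem_boundVars {𝒞 : Ctx} {u : Tm} {p : Form × ℕ} :
    p ∈ 𝒞.boundVars u ↔ 𝒞.binders[p.2]? = some p.1 ∧ u.occurs p.2 := by
  simp [boundVars, List.mem_zipIdx_iff_getElem?]

theorem mem_map_snd_boundVars {𝒞 : Ctx} {u : Tm} {n : ℕ} :
    n ∈ (𝒞.boundVars u).map Prod.snd ↔ n < 𝒞.depth ∧ u.occurs n := by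
  refine ⟨fun h => ?_, fun ⟨h, hn⟩ => List.mem_map.2
    ⟨(𝒞.binders[n]'h, n), mem_boundVars.2 ⟨List.getElem?_eq_getElem h, hn⟩, rfl⟩⟩
  obtain ⟨p, hp, rfl⟩ := List.mem_map.1 h
  exact (mem_boundVars.1 hp).imp_left fun e => (List.getElem?_eq_some_iff.1 e).1

theorem getElem?_idxOf_boundVars {𝒞 : Ctx} {u : Tm} {n : ℕ}
    (h : n ∈ (𝒞.boundVars u).map Prod.snd) :
    ((𝒞.boundVars u).map Prod.fst)[((𝒞.boundVars u).map Prod.snd).idxOf n]? = 𝒞.binders[n]? := by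
  have hi := List.idxOf_lt_length_of_mem h
  have hn := List.getElem_idxOf hi
  rw [List.length_map] at hi
  rw [List.getElem_map] at hn
  have hp := (mem_boundVars.1 (List.getElem_mem hi)).1
  rw [hn] at hp
  rw [List.getElem?_map, List.getElem?_eq_getElem hi, hp, Option.map_some]

theorem exists_eq_depth_add {𝒞 : Ctx} {u : Tm} {n : ℕ} (hu : u.occurs 𝒞.depth = false)
    (hn : u.occurs n) (h : n ∉ (𝒞.boundVars u).map Prod.snd) : ∃ j, n = 𝒞.depth + (j + 1) := by
  have hlt : ¬ n < 𝒞.depth := fun hlt => h (mem_map_snd_boundVars.2 ⟨hlt, hn⟩)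
  have hne : n ≠ 𝒞.depth := by rintro rfl; simp [hu] at hn
  exact ⟨n - 𝒞.depth - 1, by omega⟩

end Ctx

/-! ### Tuples and migration -/

theorem hasType_tupleVars {Γ : List Form} : ∀ {y : List (Form × ℕ)},
    (∀ p ∈ y, Γ[p.2]? = some p.1) → HasType Γ (tupleVars y) (conjTypes y)
  | [], _ => .lam (.var rfl)
  | [p], h => .var (h p (by simp))
  | p :: q :: l, h =>
    .pair (.var (h p (by simp))) (hasType_tupleVars (y := q :: l) fun r hr => h r (by simp [hr]))

theorem occurs_tupleVars {n : ℕ} : ∀ {y : List (Form × ℕ)},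
    (tupleVars y).occurs n → n ∈ y.map Prod.snd
  | [], h => by simp [tupleVars, Tm.tuple, Tm.occurs] at h
  | [p], h => by simpa [tupleVars, Tm.tuple, Tm.occurs] using h
  | p :: q :: l, h => by
    have h : ((Tm.var p.2).occurs n || (tupleVars (q :: l)).occurs n) = true := h
    rw [Bool.or_eq_true, Tm.occurs, beq_iff_eq] at h
    exact List.mem_cons.2 (h.imp_right occurs_tupleVars)

theorem hasType_nthProj {Γ : List Form} {F : Form} : ∀ {L : List Form} {i : ℕ} {t : Tm},
    HasType Γ t (Form.conj L) → L[i]? = some F → HasType Γ (Tm.nthProj L.length i t) F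
  | [_], 0, _, h, e => Option.some.inj e ▸ h
  | _ :: _ :: _, 0, _, h, e => Option.some.inj e ▸ .proj₀ h
  | _ :: B :: l, i + 1, t, h, e =>
    hasType_nthProj (L := B :: l) (t := .proj true t) (.proj₁ h) (by simpa using e)

theorem occurs_nthProj {m : ℕ} : ∀ {n i : ℕ} {t : Tm}, (Tm.nthProj n i t).occurs m = t.occurs m
  | 0, _, _ | 1, _, _ | _ + 2, 0, _ => rfl
  | n + 2, i + 1, t => by rw [Tm.nthProj, occurs_nthProj]; rfl

theorem hasType_migrate {Γ : List Form} {A B F : Form} {𝒞 𝒟 : Ctx} {u v : Tm}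
    (hu : HasType (𝒞.binders ++ A :: Γ) u F) (hr : u.occurs 𝒞.depth = false) :
    HasType
      (𝒟.binders ++ B :: .imp (conjTypes (𝒟.boundVars v)) (conjTypes (𝒞.boundVars u)) :: Γ)
      (migrate 𝒞.depth 𝒟.depth (𝒞.boundVars u) (𝒟.boundVars v) u) F := by
  refine hu.subst fun n G hn e => ?_
  split_ifs with hy
  · have htuple : HasType
        (𝒟.binders ++ B :: .imp (conjTypes (𝒟.boundVars v)) (conjTypes (𝒞.boundVars u)) :: Γ)
        (tupleVars (𝒟.boundVars v)) (conjTypes (𝒟.boundVars v)) :=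
      hasType_tupleVars fun p hp => by
        have hp := (Ctx.mem_boundVars.1 hp).1
        rw [List.getElem?_append_left (List.getElem?_eq_some_iff.1 hp).1, hp]
    rw [List.getElem?_append_left (Ctx.mem_map_snd_boundVars.1 hy).1,
      ← Ctx.getElem?_idxOf_boundVars hy] at e
    rw [← List.length_map (f := Prod.fst)]
    exact hasType_nthProj (.app (.var (Ctx.getElem?_binders_append 𝒟 _ 1)) htuple) e
  · obtain ⟨j, rfl⟩ := Ctx.exists_eq_depth_add hr hn hy
    rw [Ctx.getElem?_binders_append] at e
    rw [show 𝒞.depth + (j + 1) + 𝒟.depth + 1 - 𝒞.depth = 𝒟.depth + (j + 2) by omega]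
    exact .var ((Ctx.getElem?_binders_append 𝒟 _ _).trans e)

theorem occurs_migrate {𝒞 𝒟 : Ctx} {u v : Tm} {n : ℕ} (hr : u.occurs 𝒞.depth = false)
    (h : (migrate 𝒞.depth 𝒟.depth (𝒞.boundVars u) (𝒟.boundVars v) u).occurs (𝒟.depth + n)) :
    n = 1 ∧ 𝒞.boundVars u ≠ [] ∨ ∃ j, n = j + 2 ∧ u.occurs (𝒞.depth + (j + 1)) := by
  rw [migrate, Tm.occurs_subst] at h
  obtain ⟨m, hm, h⟩ := h
  split_ifs at h with hy
  · rw [occurs_nthProj, Tm.occurs, Bool.or_eq_true, Tm.occurs, beq_iff_eq] at h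
    refine .inl ⟨?_, fun h0 => by simp [h0] at hy⟩
    rcases h with h | h
    · omega
    · have := (Ctx.mem_map_snd_boundVars.1 (occurs_tupleVars h)).1
      omega
  · obtain ⟨j, rfl⟩ := Ctx.exists_eq_depth_add hr hm hy
    rw [Tm.occurs, beq_iff_eq] at h
    exact .inr ⟨j, by omega, hm⟩

theorem hasType_app_var_depth_iff {Γ : List Form} {𝒞 : Ctx} {u : Tm} {A B F : Form} :
    HasType (𝒞.binders ++ .imp A B :: Γ) (.app (.var 𝒞.depth) u) F ↔
      HasType (𝒞.binders ++ .imp A B :: Γ) u A ∧ B = F := by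
  have := 𝒞.getElem?_binders_append (.imp A B :: Γ) 0
  simp_all [hasType_app_iff, hasType_var_iff, and_comm]

theorem hasType_fill_migrate {Γ : List Form} {A B C : Form} {𝒞 𝒟 : Ctx} {u v : Tm}
    (hC : HasType (.imp A B :: Γ) (𝒞.fillComm u) C)
    (hD : HasType (.imp B A :: Γ) (𝒟.fillComm v) C) (hr : u.occurs 𝒞.depth = false) :
    HasType (.imp B A :: .imp (conjTypes (𝒟.boundVars v)) (conjTypes (𝒞.boundVars u)) :: Γ)
      ((𝒟.rename (liftRen Nat.succ)).fill
        (migrate 𝒞.depth 𝒟.depth (𝒞.boundVars u) (𝒟.boundVars v) u)) C := by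
  obtain ⟨F, -, hu⟩ := Ctx.hasType_fill_iff.1 hC
  obtain ⟨G, h𝒟, hv⟩ := Ctx.hasType_fill_iff.1 hD
  obtain ⟨hu, -⟩ := hasType_app_var_depth_iff.1 hu
  obtain ⟨-, rfl⟩ := hasType_app_var_depth_iff.1 hv
  refine Ctx.hasType_fill_iff.2 ⟨A, h𝒟.rename fun n _ => ?_, ?_⟩
  · cases n <;> simp [liftRen]
  · rw [Ctx.binders_rename]
    exact hasType_migrate hu hr

/-! ### Subject reduction -/

theorem Intuitionistic.hasType {Γ : List Form} {t t' : Tm} {A : Form} (h : Intuitionistic t t')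
    (ht : HasType Γ t A) : HasType Γ t' A := by
  cases h with
  | beta => cases ht with | app h hs => cases h with | lam hu => exact hu.inst hs
  | proj₀ => cases ht with | proj₀ h => cases h with | pair h _ => exact h
  | proj₁ => cases ht with | proj₁ h => cases h with | pair _ h => exact h

theorem Permutation.hasType {Γ : List Form} {t t' : Tm} {A : Form} (h : Permutation Γ t t')
    (ht : HasType Γ t A) : HasType Γ t' A := by
  cases h <;>
    simp only [hasType_lam_iff, hasType_app_iff, hasType_pair_iff, hasType_proj_iff,
      hasType_efq_iff, hasType_par_iff, hasType_shift_iff, hasType_rename_swapRen_iff,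
      hasType_rename_liftRen_succ_iff] at ht ⊢ <;>
    grind

theorem Cross.hasType {Γ : List Form} {t t' : Tm} {A : Form} (h : Cross Γ t t')
    (ht : HasType Γ t A) : HasType Γ t' A := by
  cases h with
  | left => exact hasType_shift_iff.1 (hasType_par_iff.1 ht).1
  | right => exact hasType_shift_iff.1 (hasType_par_iff.1 ht).2
  | cross A B 𝒞 𝒟 u v y z _ _ _ _ hu hv hy hz _ =>
    subst hy hz
    obtain ⟨h₁, h₂⟩ := hasType_par_iff.1 ht
    exact .par
      (.par (hasType_fill_migrate h₁ h₂ hu.2) (hasType_rename_liftRen_succ_iff.2 h₁))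
      (.par (hasType_fill_migrate h₂ h₁ hv.2) (hasType_rename_liftRen_succ_iff.2 h₂))

theorem Basic.hasType {Γ : List Form} {t t' : Tm} {A : Form} :
    Basic Γ t t' → HasType Γ t A → HasType Γ t' A
  | .int h => h.hasType
  | .perm h => h.hasType
  | .cross h => h.hasType

theorem Compat.hasType {R : List Form → Tm → Tm → Prop} {Γ : List Form} {t t' : Tm} {A : Form}
    (hR : ∀ {Γ t t' A}, R Γ t t' → HasType Γ t A → HasType Γ t' A) (h : Compat R Γ t t')
    (ht : HasType Γ t A) : HasType Γ t' A := by
  induction h generalizing A with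
  | base h => exact hR h ht
  | _ =>
    simp only [hasType_lam_iff, hasType_app_iff, hasType_pair_iff, hasType_proj_iff,
      hasType_efq_iff, hasType_par_iff] at ht ⊢
    grind

/-! ### Reduction does not create free variables -/

theorem occurs_rename_liftRen_succ {t : Tm} {n : ℕ} :
    (t.rename (liftRen Nat.succ)).occurs (n + 2) = t.occurs (n + 1) := by
  rw [Bool.eq_iff_iff, Tm.occurs_rename, exists_liftRen_eq_succ]
  simp

theorem occurs_rename_swapRen {t : Tm} {n : ℕ} :
    (t.rename swapRen).occurs (n + 2) = t.occurs (n + 2) := by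
  rw [Bool.eq_iff_iff, Tm.occurs_rename, ← Nat.or_exists_add_one, ← Nat.or_exists_add_one]
  simp [swapRen]

theorem occurs_fill_migrate {𝒞 𝒟 : Ctx} {u v : Tm} {n : ℕ} (hr : u.occurs 𝒞.depth = false)
    (h : ((𝒟.rename (liftRen Nat.succ)).fill
        (migrate 𝒞.depth 𝒟.depth (𝒞.boundVars u) (𝒟.boundVars v) u)).occurs (n + 2)) :
    (𝒞.fillComm u).occurs (n + 1) ∨ (𝒟.fillComm v).occurs (n + 1) := by
  rw [Ctx.occurs_fill, Ctx.occurs_rename, exists_liftRen_eq_succ, Ctx.depth_rename] at h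
  rw [Ctx.occurs_fillComm, Ctx.occurs_fillComm]
  rcases h with ⟨m, h, e⟩ | h
  · obtain rfl : m = n := Nat.succ.inj e
    exact .inr (.inl h)
  · rcases occurs_migrate hr h with ⟨h, -⟩ | ⟨j, hj, h⟩
    · omega
    · obtain rfl : n = j := by omega
      exact .inl (.inr h)

theorem Basic.occurs {Γ : List Form} {t t' : Tm} {n : ℕ} (h : Basic Γ t t') (hn : t'.occurs n) :
    t.occurs n := by
  cases h with
  | int h =>
    cases h with
    | beta A u s => simpa [Tm.occurs] using Tm.occurs_inst hn
    | proj₀ | proj₁ => simp [Tm.occurs, hn]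
  | perm h =>
    cases h <;>
      simp only [Tm.occurs, Tm.occurs_shift_succ, occurs_rename_swapRen,
        occurs_rename_liftRen_succ, Bool.or_eq_true] at hn ⊢ <;>
      tauto
  | cross h =>
    cases h with
    | left | right => simp [Tm.occurs, Tm.occurs_shift_succ, hn]
    | cross A B 𝒞 𝒟 u v y z _ _ _ _ hu hv hy hz _ =>
      subst hy hz
      simp only [Tm.occurs, occurs_rename_liftRen_succ, Bool.or_eq_true] at hn ⊢
      rcases hn with (h | h) | (h | h)
      · exact occurs_fill_migrate hu.2 h
      · exact .inl h
      · exact (occurs_fill_migrate hv.2 h).symm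
      · exact .inr h

theorem Compat.occurs {R : List Form → Tm → Tm → Prop} {Γ : List Form} {t t' : Tm} {n : ℕ}
    (hR : ∀ {Γ t t' n}, R Γ t t' → t'.occurs n → t.occurs n) (h : Compat R Γ t t')
    (hn : t'.occurs n) : t.occurs n := by
  induction h generalizing n with
  | base h => exact hR h hn
  | lam _ ih | proj _ ih | efq _ ih => exact ih hn
  | _ =>
    simp only [Tm.occurs, Bool.or_eq_true] at hn ⊢
    tauto

/-! ### Reduction in finitely many steps -/

theorem Compat.mono {R R' : List Form → Tm → Tm → Prop} {Γ : List Form} {t t' : Tm}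
    (hR : ∀ {Γ t t'}, R Γ t t' → R' Γ t t') (h : Compat R Γ t t') : Compat R' Γ t t' := by
  induction h with
  | base h => exact .base (hR h)
  | lam _ ih => exact .lam ih
  | appL _ ih => exact .appL ih
  | appR _ ih => exact .appR ih
  | pairL _ ih => exact .pairL ih
  | pairR _ ih => exact .pairR ih
  | proj _ ih => exact .proj ih
  | efq _ ih => exact .efq ih
  | parL _ ih => exact .parL ih
  | parR _ ih => exact .parR ih

/-- The reflexive transitive closure of the closure of `R` under all contexts. -/
abbrev CompatStar (R : List Form → Tm → Tm → Prop) (Γ : List Form) : Tm → Tm → Prop :=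
  ReflTransGen (Compat R Γ)

namespace CompatStar

variable {R : List Form → Tm → Tm → Prop} {Γ : List Form} {t t' u u' v v' : Tm} {A B : Form}

theorem hasType (hR : ∀ {Γ t t' A}, R Γ t t' → HasType Γ t A → HasType Γ t' A)
    (h : CompatStar R Γ t t') (ht : HasType Γ t A) : HasType Γ t' A := by
  induction h with
  | refl => exact ht
  | tail _ h ih => exact h.hasType hR ih

theorem occurs {n : ℕ} (hR : ∀ {Γ t t' n}, R Γ t t' → t'.occurs n → t.occurs n)
    (h : CompatStar R Γ t t') (hn : t'.occurs n) : t.occurs n := by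
  induction h with
  | refl => exact hn
  | tail _ h ih => exact ih (h.occurs hR hn)

theorem lam (h : CompatStar R (A :: Γ) u u') : CompatStar R Γ (.lam A u) (.lam A u') :=
  h.lift (Tm.lam A) fun _ _ => .lam

theorem app (h : CompatStar R Γ t t') (h' : CompatStar R Γ u u') :
    CompatStar R Γ (.app t u) (.app t' u') :=
  (h.lift (Tm.app · u) fun _ _ => .appL).trans (h'.lift (Tm.app t') fun _ _ => .appR)

theorem pair (h : CompatStar R Γ t t') (h' : CompatStar R Γ u u') :
    CompatStar R Γ (.pair t u) (.pair t' u') :=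
  (h.lift (Tm.pair · u) fun _ _ => .pairL).trans (h'.lift (Tm.pair t') fun _ _ => .pairR)

theorem proj {i : Bool} (h : CompatStar R Γ u u') : CompatStar R Γ (.proj i u) (.proj i u') :=
  h.lift (Tm.proj i) fun _ _ => .proj

theorem efq {P : ℕ} (h : CompatStar R Γ u u') : CompatStar R Γ (.efq P u) (.efq P u') :=
  h.lift (Tm.efq P) fun _ _ => .efq

theorem par (h : CompatStar R (.imp A B :: Γ) u u') (h' : CompatStar R (.imp B A :: Γ) v v') :
    CompatStar R Γ (.par A B u v) (.par A B u' v') :=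
  (h.lift (Tm.par A B · v) fun _ _ => .parL).trans (h'.lift (Tm.par A B u') fun _ _ => .parR)

end CompatStar

/-- The relation `↦*`. -/
abbrev Steps (Γ : List Form) : Tm → Tm → Prop := CompatStar Basic Γ

theorem Steps.hasType {Γ : List Form} {t t' : Tm} {A : Form} (h : Steps Γ t t')
    (ht : HasType Γ t A) : HasType Γ t' A :=
  CompatStar.hasType Basic.hasType h ht

theorem Steps.occurs {Γ : List Form} {t t' : Tm} {n : ℕ} (h : Steps Γ t t')
    (hn : t'.occurs n) : t.occurs n :=
  CompatStar.occurs Basic.occurs h hn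

/-! ### Weak normalization of simply typed terms -/

theorem Compat.rename_intuitionistic {Γ Δ : List Form} {t t' : Tm} {ρ : ℕ → ℕ}
    (h : Compat (fun _ => Intuitionistic) Γ t t') :
    Compat (fun _ => Intuitionistic) Δ (t.rename ρ) (t'.rename ρ) := by
  induction h generalizing Δ ρ with
  | base h =>
    refine .base ?_
    cases h with
    | beta A u s => rw [Tm.rename_inst]; exact .beta _ _ _
    | proj₀ => exact .proj₀ _ _
    | proj₁ => exact .proj₁ _ _
  | lam _ ih => exact .lam ih
  | appL _ ih => exact .appL ih
  | appR _ ih => exact .appR ih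
  | pairL _ ih => exact .pairL ih
  | pairR _ ih => exact .pairR ih
  | proj _ ih => exact .proj ih
  | efq _ ih => exact .efq ih
  | parL _ ih => exact .parL ih
  | parR _ ih => exact .parR ih

/-- Reduction in finitely many intuitionistic steps. It does not depend on the scope, over which it
is therefore quantified. -/
def IntSteps (t t' : Tm) : Prop := ∀ Γ : List Form, CompatStar (fun _ => Intuitionistic) Γ t t'

namespace IntSteps

variable {t t' t'' u u' : Tm} {A : Form}

theorem refl (t : Tm) : IntSteps t t := fun _ => .refl

theorem trans (h : IntSteps t t') (h' : IntSteps t' t'') : IntSteps t t'' :=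
  fun Γ => (h Γ).trans (h' Γ)

theorem of_intuitionistic (h : Intuitionistic t t') : IntSteps t t' := fun _ => .single (.base h)

theorem steps (h : IntSteps t t') (Γ : List Form) : Steps Γ t t' :=
  (h Γ).lift id fun _ _ => Compat.mono fun h => .int h

theorem lam (h : IntSteps u u') : IntSteps (.lam A u) (.lam A u') := fun _ => (h _).lam

theorem app (h : IntSteps t t') (h' : IntSteps u u') : IntSteps (.app t u) (.app t' u') :=
  fun Γ => (h Γ).app (h' Γ)

theorem pair (h : IntSteps t t') (h' : IntSteps u u') : IntSteps (.pair t u) (.pair t' u') :=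
  fun Γ => (h Γ).pair (h' Γ)

theorem proj {i : Bool} (h : IntSteps u u') : IntSteps (.proj i u) (.proj i u') :=
  fun Γ => (h Γ).proj

theorem efq {P : ℕ} (h : IntSteps u u') : IntSteps (.efq P u) (.efq P u') :=
  fun Γ => (h Γ).efq

theorem rename (h : IntSteps t t') (ρ : ℕ → ℕ) : IntSteps (t.rename ρ) (t'.rename ρ) :=
  fun Γ => (h Γ).lift (Tm.rename ρ) fun _ _ => Compat.rename_intuitionistic

end IntSteps

namespace Tm

/-- Terms that are not introductions: they create no redex when they are applied or projected. -/
def Neutral : Tm → Prop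
  | lam _ _ | pair _ _ => False
  | _ => True

/-- Simply typed λ-terms in which only neutral terms are applied or projected. For typed terms this
is normality; for untyped ones it is stronger, since a pair may not be applied, nor an abstraction
projected. -/
def Nf : Tm → Prop
  | var _ => True
  | lam _ u => Nf u
  | app t u => t.Neutral ∧ Nf t ∧ Nf u
  | pair u t => Nf u ∧ Nf t
  | proj _ u => u.Neutral ∧ Nf u
  | efq _ u => Nf u
  | par _ _ _ _ => False

theorem neutral_rename {t : Tm} {ρ : ℕ → ℕ} : (t.rename ρ).Neutral ↔ t.Neutral := by
  cases t <;> rfl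

theorem nf_rename {t : Tm} {ρ : ℕ → ℕ} : (t.rename ρ).Nf ↔ t.Nf := by
  induction t generalizing ρ <;> simp_all [rename, Nf, neutral_rename]

theorem Nf.parFree {t : Tm} (h : t.Nf) : t.ParFree := by
  induction t <;> simp_all [Nf, ParFree]

theorem Nf.intNormal {t : Tm} (h : t.Nf) : IntNormal t := by
  intro t' hs
  generalize [] = Γ at hs
  induction hs with
  | base hb => cases hb <;> exact h.1
  | lam _ ih | efq _ ih => exact ih h
  | appL _ ih => exact ih h.2.1
  | appR _ ih => exact ih h.2.2
  | pairL _ ih => exact ih h.1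
  | pairR _ ih | proj _ ih => exact ih h.2
  | parL | parR => exact h

end Tm

/-- The term has an intuitionistic normal form. -/
def WN (t : Tm) : Prop := ∃ t', IntSteps t t' ∧ t'.Nf

/-- Tait's reducibility predicates. Since terms are not typed intrinsically, the clause for `→`
quantifies over renamings instead of extensions of the scope. -/
def Red : Form → Tm → Prop
  | .bot, t | .atom _, t => WN t
  | .and A B, t => WN t ∧ Red A (.proj false t) ∧ Red B (.proj true t)
  | .imp A B, t => WN t ∧ ∀ (ρ : ℕ → ℕ) (u : Tm), Red A u → Red B (.app (t.rename ρ) u)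

theorem Tm.Nf.wn {t : Tm} (h : t.Nf) : WN t := ⟨t, .refl t, h⟩

theorem WN.rename {t : Tm} (ρ : ℕ → ℕ) : WN t → WN (t.rename ρ)
  | ⟨_, h, hn⟩ => ⟨_, h.rename ρ, Tm.nf_rename.2 hn⟩

theorem WN.expand {t t' : Tm} (h : IntSteps t t') : WN t' → WN t
  | ⟨s, hs, hn⟩ => ⟨s, h.trans hs, hn⟩

theorem Red.wn : ∀ {A : Form} {t : Tm}, Red A t → WN t
  | .bot, _, h | .atom _, _, h => h
  | .and _ _, _, h | .imp _ _, _, h => h.1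

theorem Red.expand : ∀ {A : Form} {t t' : Tm}, IntSteps t t' → Red A t' → Red A t
  | .bot, _, _, h, h' | .atom _, _, _, h, h' => WN.expand h h'
  | .and _ _, _, _, h, ⟨hw, hA, hB⟩ => ⟨hw.expand h, hA.expand h.proj, hB.expand h.proj⟩
  | .imp _ _, _, _, h, ⟨hw, hB⟩ =>
    ⟨hw.expand h, fun ρ u hu => (hB ρ u hu).expand ((h.rename ρ).app (.refl u))⟩

theorem Red.rename : ∀ {A : Form} {t : Tm} (ρ : ℕ → ℕ), Red A t → Red A (t.rename ρ)
  | .bot, _, ρ, h | .atom _, _, ρ, h => WN.rename ρ h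
  | .and _ _, _, ρ, ⟨h, hA, hB⟩ => ⟨h.rename ρ, hA.rename ρ, hB.rename ρ⟩
  | .imp _ _, t, ρ, ⟨h, hB⟩ =>
    ⟨h.rename ρ, fun ρ' u hu => t.rename_rename ρ ρ' ▸ hB (ρ' ∘ ρ) u hu⟩

theorem red_of_neutral : ∀ {A : Form} {t : Tm}, t.Nf → t.Neutral → Red A t
  | .bot, _, h, _ | .atom _, _, h, _ => h.wn
  | .and _ _, _, h, hn =>
    ⟨h.wn, red_of_neutral (t := .proj _ _) ⟨hn, h⟩ trivial,
      red_of_neutral (t := .proj _ _) ⟨hn, h⟩ trivial⟩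
  | .imp _ _, _, h, hn => by
    refine ⟨h.wn, fun ρ u hu => ?_⟩
    obtain ⟨u', hs, hu'⟩ := hu.wn
    exact (red_of_neutral (t := .app _ u') ⟨Tm.neutral_rename.2 hn, Tm.nf_rename.2 h, hu'⟩
      trivial).expand ((IntSteps.refl _).app hs)

theorem HasType.red {Γ : List Form} {t : Tm} {A : Form} {σ : ℕ → Tm} (h : HasType Γ t A)
    (hp : t.ParFree) (hσ : ∀ n F, Γ[n]? = some F → Red F (σ n)) : Red A (t.subst σ) := by
  induction h generalizing σ with
  | var e => exact hσ _ _ e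
  | @lam Γ A B u _ ih =>
    have body : ∀ {τ : ℕ → Tm} (_ : Red A (τ 0)) (_ : ∀ n F, Γ[n]? = some F → Red F (τ (n + 1))),
        Red B (u.subst τ) := fun h₀ h => ih hp fun
      | 0, _, e => Option.some.inj e ▸ h₀
      | n + 1, F, e => h n F e
    refine ⟨?_, fun ρ w hw => ?_⟩
    · obtain ⟨u', hs, hn⟩ := (body (τ := Tm.liftSub σ) (red_of_neutral trivial trivial)
        fun n F e => (hσ n F e).rename _).wn
      exact ⟨.lam A u', hs.lam, hn⟩
    · refine Red.expand (.of_intuitionistic (.beta _ _ _)) ?_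
      rw [Tm.inst_rename_subst_liftSub]
      exact body hw fun n F e => (hσ n F e).rename ρ
  | app _ _ iht ihu =>
    have := (iht hp.1 hσ).2 id _ (ihu hp.2 hσ)
    rwa [Tm.rename_id] at this
  | pair _ _ ihu iht =>
    have hu := ihu hp.1 hσ
    have ht := iht hp.2 hσ
    obtain ⟨u', hsu, hnu⟩ := hu.wn
    obtain ⟨t', hst, hnt⟩ := ht.wn
    exact ⟨⟨_, hsu.pair hst, hnu, hnt⟩, hu.expand (.of_intuitionistic (.proj₀ _ _)),
      ht.expand (.of_intuitionistic (.proj₁ _ _))⟩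
  | proj₀ _ ih => exact (ih hp hσ).2.1
  | proj₁ _ ih => exact (ih hp hσ).2.2
  | efq _ ih =>
    obtain ⟨u', hs, hn⟩ := (ih hp hσ).wn
    exact ⟨_, hs.efq, hn⟩
  | par => exact hp.elim

theorem HasType.wn {Γ : List Form} {t : Tm} {A : Form} (h : HasType Γ t A) (hp : t.ParFree) :
    WN t := by
  have := h.red hp (σ := Tm.var) fun _ _ _ => red_of_neutral trivial trivial
  rw [Tm.subst_var] at this
  exact this.wn

/-! ### Subformulas and prime factors -/

namespace Form

theorem mem_subformulas_self (A : Form) : A ∈ A.subformulas := by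
  cases A <;> simp [subformulas]

theorem subformulas_trans {A B C : Form} (h : A ∈ B.subformulas) (h' : B ∈ C.subformulas) :
    A ∈ C.subformulas := by
  induction C with
  | bot | atom n => rwa [Finset.mem_singleton.1 h'] at h
  | and C D ihC ihD | imp C D ihC ihD =>
    simp only [subformulas, Finset.mem_insert, Finset.mem_union] at h'
    rcases h' with rfl | h' | h'
    · exact h
    · simp [subformulas, ihC h']
    · simp [subformulas, ihD h']

theorem eq_or_symbols_lt {A B : Form} (h : A ∈ B.subformulas) :
    A = B ∨ A.symbols < B.symbols := by
  induction B with
  | bot | atom n => exact .inl (Finset.mem_singleton.1 h)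
  | and C D ihC ihD | imp C D ihC ihD =>
    simp only [subformulas, Finset.mem_insert, Finset.mem_union] at h
    rcases h with rfl | h | h
    · exact .inl rfl
    · rcases ihC h with rfl | h <;> simp only [symbols] <;> omega
    · rcases ihD h with rfl | h <;> simp only [symbols] <;> omega

theorem symbols_le_of_mem {A B : Form} (h : A ∈ B.subformulas) : A.symbols ≤ B.symbols :=
  (eq_or_symbols_lt h).elim (fun e => e ▸ le_rfl) le_of_lt

theorem ProperSubformula.symbols_lt {A B : Form} (h : ProperSubformula A B) :
    A.symbols < B.symbols :=
  (eq_or_symbols_lt h.1).resolve_left h.2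

theorem properSubformula_of_mem {P A B : Form} (h : P ∈ A.subformulas)
    (h' : ProperSubformula A B) : ProperSubformula P B :=
  ⟨subformulas_trans h h'.1, fun e => absurd h'.symbols_lt (e ▸ symbols_le_of_mem h).not_gt⟩

theorem ProperSubformula.trans_mem {P A B : Form} (h : ProperSubformula P A)
    (h' : A ∈ B.subformulas) : ProperSubformula P B := by
  by_cases e : A = B
  · exact e ▸ h
  · exact properSubformula_of_mem h.1 ⟨h', e⟩

theorem properSubformula_imp {P A B : Form} :
    ProperSubformula P (imp A B) ↔ P ∈ A.subformulas ∨ P ∈ B.subformulas := by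
  refine ⟨fun ⟨h, h'⟩ => by simpa [subformulas, h'] using h,
    fun h => ⟨by simp [subformulas, h], ?_⟩⟩
  rintro rfl
  have := h.imp symbols_le_of_mem symbols_le_of_mem
  simp only [symbols] at this
  omega

theorem StrongSubformula.trans_mem {P A B : Form} :
    StrongSubformula P A → A ∈ B.subformulas → StrongSubformula P B
  | ⟨Q, hQ, hQA, hPQ⟩, h => ⟨Q, hQ, hQA.trans_mem h, hPQ⟩

theorem strongSubformula_of_mem {P Q A : Form} (h : P ∈ Q.subformulas) :
    StrongSubformula Q A → StrongSubformula P A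
  | ⟨R, hR, hRA, hQR⟩ => ⟨R, hR, hRA, properSubformula_of_mem h hQR⟩

theorem StrongSubformula.properSubformula {P A : Form} :
    StrongSubformula P A → ProperSubformula P A
  | ⟨_, _, hQA, hPQ⟩ => properSubformula_of_mem hPQ.1 hQA

theorem mem_subformulas_of_mem_primeFactors {P A : Form} (h : P ∈ A.primeFactors) :
    P ∈ A.subformulas := by
  induction A with
  | bot | atom n | imp B C => rw [Finset.mem_singleton.1 h]; exact mem_subformulas_self _
  | and B C ihB ihC =>
    simp only [primeFactors, Finset.mem_union] at h
    simp only [subformulas, Finset.mem_insert, Finset.mem_union]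
    exact .inr (h.imp ihB ihC)

theorem isPrime_of_mem_primeFactors {P A : Form} (h : P ∈ A.primeFactors) : P.IsPrime := by
  induction A with
  | bot | atom n | imp B C => rw [Finset.mem_singleton.1 h]; nofun
  | and B C ihB ihC => exact (Finset.mem_union.1 h).elim ihB ihC

theorem exists_primeFactor {Q A : Form} (h : Q ∈ A.subformulas) (hQ : Q.IsPrime) :
    ∃ R ∈ A.primeFactors, Q ∈ R.subformulas := by
  induction A with
  | bot | atom n | imp B C => exact ⟨_, Finset.mem_singleton_self _, h⟩
  | and B C ihB ihC =>
    simp only [subformulas, Finset.mem_insert, Finset.mem_union] at h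
    simp only [primeFactors, Finset.mem_union, or_and_right, exists_or]
    rcases h with rfl | h | h
    · exact absurd rfl (hQ B C)
    · exact .inl (ihB h)
    · exact .inr (ihC h)

theorem mem_primeFactors_conj {P : Form} : ∀ {L : List Form}, L ≠ [] →
    P ∈ (conj L).primeFactors → ∃ A ∈ L, P ∈ A.primeFactors
  | [A], _, h => ⟨A, by simp, h⟩
  | A :: B :: l, _, h => by
    simp only [conj, primeFactors, Finset.mem_union] at h
    rcases h with h | h
    · exact ⟨A, by simp, h⟩
    · obtain ⟨C, hC, hP⟩ := mem_primeFactors_conj (List.cons_ne_nil B l) h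
      exact ⟨C, List.mem_cons_of_mem A hC, hP⟩

/-- A set of formulas that contains the subformulas of its members. The normalization argument
measures communication kinds by their prime factors outside of such a set. -/
def SubClosed (S : Set Form) : Prop := ∀ ⦃P Q⦄, Q ∈ S → P ∈ Q.subformulas → P ∈ S

/-- The strong subformulas of `A` belong to `S`: for a subformula-closed `S`, what is required of
the type of a variable. -/
def StrongIn (S : Set Form) (A : Form) : Prop := ∀ P, StrongSubformula P A → P ∈ S

/-- The proper subformulas of the prime factors of `A` belong to `S`: for a subformula-closed `S`,
what is required of the type of a term. -/
def BelowPrimesIn (S : Set Form) (A : Form) : Prop :=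
  ∀ Q ∈ A.primeFactors, ∀ P, ProperSubformula P Q → P ∈ S

/-- The prime factors of `A` belong to `S`: what the formulas of communication kinds are brought to
satisfy. -/
def PrimesIn (S : Set Form) (A : Form) : Prop := ∀ P ∈ A.primeFactors, P ∈ S

variable {S : Set Form} {A B : Form}

theorem StrongIn.of_and (h : StrongIn S (and A B)) : StrongIn S A ∧ StrongIn S B :=
  ⟨fun P hP => h P (hP.trans_mem (by simp [subformulas, mem_subformulas_self])),
    fun P hP => h P (hP.trans_mem (by simp [subformulas, mem_subformulas_self]))⟩

theorem StrongIn.of_imp (h : StrongIn S (imp A B)) : BelowPrimesIn S A ∧ StrongIn S B :=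
  ⟨fun Q hQ P hP => h P ⟨Q, isPrime_of_mem_primeFactors hQ,
      properSubformula_imp.2 (.inl (mem_subformulas_of_mem_primeFactors hQ)), hP⟩,
    fun P hP => h P (hP.trans_mem (by simp [subformulas, mem_subformulas_self]))⟩

theorem strongIn_imp (hA : BelowPrimesIn S A) (hB : BelowPrimesIn S B) : StrongIn S (imp A B) := by
  rintro P ⟨Q, hQ, hQ', hP⟩
  rcases properSubformula_imp.1 hQ' with h | h
  · obtain ⟨R, hR, hR'⟩ := exists_primeFactor h hQ
    exact hA R hR P (hP.trans_mem hR')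
  · obtain ⟨R, hR, hR'⟩ := exists_primeFactor h hQ
    exact hB R hR P (hP.trans_mem hR')

theorem strongIn_atom (n : ℕ) : StrongIn S (atom n) := by
  rintro P ⟨Q, -, ⟨h, h'⟩, -⟩
  exact absurd (Finset.mem_singleton.1 h) h'

theorem belowPrimesIn_bot : BelowPrimesIn S bot := by
  rintro Q h P ⟨h', h''⟩
  obtain rfl := Finset.mem_singleton.1 h
  exact absurd (Finset.mem_singleton.1 h') h''

theorem BelowPrimesIn.of_and (h : BelowPrimesIn S (and A B)) :
    BelowPrimesIn S A ∧ BelowPrimesIn S B :=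
  ⟨fun Q hQ => h Q (Finset.mem_union_left _ hQ), fun Q hQ => h Q (Finset.mem_union_right _ hQ)⟩

theorem BelowPrimesIn.of_imp (h : BelowPrimesIn S (imp A B)) : A ∈ S ∧ B ∈ S :=
  have h := h (imp A B) (Finset.mem_singleton_self _)
  ⟨h _ (properSubformula_imp.2 (.inl A.mem_subformulas_self)),
    h _ (properSubformula_imp.2 (.inr B.mem_subformulas_self))⟩

theorem belowPrimesIn_of_properSubformula (h : ∀ P, ProperSubformula P A → P ∈ S) :
    BelowPrimesIn S A :=
  fun _ hQ P hP => h P (hP.trans_mem (mem_subformulas_of_mem_primeFactors hQ))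

theorem SubClosed.strongIn (hS : SubClosed S) (h : A ∈ S) : StrongIn S A :=
  fun _ hP => hS h hP.properSubformula.1

theorem SubClosed.primesIn (hS : SubClosed S) (h : A ∈ S) : PrimesIn S A :=
  fun _ hP => hS h (mem_subformulas_of_mem_primeFactors hP)

theorem SubClosed.belowPrimesIn (hS : SubClosed S) (h : PrimesIn S A) : BelowPrimesIn S A :=
  fun Q hQ _ hP => hS (h Q hQ) hP.1

end Form

/-! ### The subformula property -/

/-- The strong subformulas of the types of the free variables of `t` belong to `S`. -/
def FreeStrongIn (S : Set Form) (Γ : List Form) (t : Tm) : Prop :=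
  ∀ n F, t.occurs n → Γ[n]? = some F → F.StrongIn S

theorem FreeStrongIn.mono {S : Set Form} {Γ : List Form} {t u : Tm} (h : FreeStrongIn S Γ t)
    (hu : ∀ n, u.occurs n → t.occurs n) : FreeStrongIn S Γ u :=
  fun n F hn => h n F (hu n hn)

theorem FreeStrongIn.of_app {S : Set Form} {Γ : List Form} {t u : Tm}
    (h : FreeStrongIn S Γ (.app t u)) : FreeStrongIn S Γ t ∧ FreeStrongIn S Γ u :=
  ⟨h.mono fun _ h => by simp [Tm.occurs, h], h.mono fun _ h => by simp [Tm.occurs, h]⟩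

theorem FreeStrongIn.of_pair {S : Set Form} {Γ : List Form} {t u : Tm}
    (h : FreeStrongIn S Γ (.pair t u)) : FreeStrongIn S Γ t ∧ FreeStrongIn S Γ u :=
  ⟨h.mono fun _ h => by simp [Tm.occurs, h], h.mono fun _ h => by simp [Tm.occurs, h]⟩

theorem FreeStrongIn.cons {S : Set Form} {Γ : List Form} {A : Form} {t u : Tm}
    (h : FreeStrongIn S Γ t) (hu : ∀ n, u.occurs (n + 1) → t.occurs n)
    (hA : u.occurs 0 → A.StrongIn S) : FreeStrongIn S (A :: Γ) u
  | 0, _, hn, e => Option.some.inj e ▸ hA hn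
  | n + 1, F, hn, e => h n F (hu n hn) e

namespace Tm

/-- The types of the λ-variables bound in the term belong to `S`. -/
def BindersIn (S : Set Form) : Tm → Prop
  | var _ => True
  | lam A u => A ∈ S ∧ BindersIn S u
  | app t u => BindersIn S t ∧ BindersIn S u
  | pair u t => BindersIn S u ∧ BindersIn S t
  | proj _ u => BindersIn S u
  | efq _ u => BindersIn S u
  | par _ _ u v => BindersIn S u ∧ BindersIn S v

/-- Each occurrence of the variable `n` is applied to an argument. This is what allows cross
reduction to act on the rightmost occurrence of a communication variable. -/
def Applied : ℕ → Tm → Prop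
  | n, var m => m ≠ n
  | n, lam _ u => Applied (n + 1) u
  | n, app t u => (t = var n ∨ Applied n t) ∧ Applied n u
  | n, pair u t => Applied n u ∧ Applied n t
  | n, proj _ u => Applied n u
  | n, efq _ u => Applied n u
  | n, par _ _ u v => Applied (n + 1) u ∧ Applied (n + 1) v

variable {S : Set Form} {Γ : List Form} {t : Tm} {A : Form}

theorem Nf.strongIn (h : HasType Γ t A) (hn : t.Nf) (hneut : t.Neutral)
    (hf : FreeStrongIn S Γ t) : A.StrongIn S := by
  induction h with
  | var e => exact hf _ _ (by simp [occurs]) e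
  | lam | pair => exact hneut.elim
  | app _ _ iht => exact (iht hn.2.1 hn.1 hf.of_app.1).of_imp.2
  | proj₀ _ ih => exact (ih hn.2 hn.1 hf).of_and.1
  | proj₁ _ ih => exact (ih hn.2 hn.1 hf).of_and.2
  | efq => exact Form.strongIn_atom _
  | par => exact hn.elim

theorem Nf.bindersIn (hS : Form.SubClosed S) (h : HasType Γ t A) (hn : t.Nf)
    (hf : FreeStrongIn S Γ t) (hA : t.Neutral ∨ A.BelowPrimesIn S) : t.BindersIn S := by
  induction h with
  | var => trivial
  | lam _ ih =>
    obtain ⟨hA, hB⟩ := (hA.resolve_left id).of_imp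
    exact ⟨hA, ih hn (hf.cons (fun _ => id) fun _ => hS.strongIn hA)
      (.inr (hS.belowPrimesIn (hS.primesIn hB)))⟩
  | app ht _ iht ihu =>
    obtain ⟨hft, hfu⟩ := hf.of_app
    exact ⟨iht hn.2.1 hft (.inl hn.1),
      ihu hn.2.2 hfu (.inr (hn.2.1.strongIn ht hn.1 hft).of_imp.1)⟩
  | pair _ _ ihu iht =>
    obtain ⟨hA, hB⟩ := (hA.resolve_left id).of_and
    exact ⟨ihu hn.1 hf.of_pair.1 (.inr hA), iht hn.2 hf.of_pair.2 (.inr hB)⟩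
  | proj₀ _ ih | proj₁ _ ih => exact ih hn.2 hf (.inl hn.1)
  | efq _ ih => exact ih hn hf (.inr Form.belowPrimesIn_bot)
  | par => exact hn.elim

theorem Nf.applied {n : ℕ} {D E : Form} (hS : Form.SubClosed S) (h : HasType Γ t A) (hn : t.Nf)
    (hf : FreeStrongIn S Γ t) (hA : t.Neutral ∧ t ≠ var n ∨ A.BelowPrimesIn S)
    (e : Γ[n]? = some (.imp D E)) (hDE : ¬ (D ∈ S ∧ E ∈ S)) : t.Applied n := by
  induction h generalizing n with
  | var e' =>
    rintro rfl
    rcases hA with ⟨-, hne⟩ | hA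
    · exact hne rfl
    · exact hDE (Form.BelowPrimesIn.of_imp (Option.some.inj (e'.symm.trans e) ▸ hA))
  | lam _ ih =>
    obtain ⟨hA, hB⟩ := (hA.resolve_left And.left).of_imp
    exact ih hn (hf.cons (fun _ => id) fun _ => hS.strongIn hA)
      (.inr (hS.belowPrimesIn (hS.primesIn hB))) e
  | app ht _ iht ihu =>
    obtain ⟨hft, hfu⟩ := hf.of_app
    exact ⟨or_iff_not_imp_left.2 fun hne => iht hn.2.1 hft (.inl ⟨hn.1, hne⟩) e,
      ihu hn.2.2 hfu (.inr (hn.2.1.strongIn ht hn.1 hft).of_imp.1) e⟩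
  | pair _ _ ihu iht =>
    obtain ⟨hA, hB⟩ := (hA.resolve_left And.left).of_and
    exact ⟨ihu hn.1 hf.of_pair.1 (.inr hA) e, iht hn.2 hf.of_pair.2 (.inr hB) e⟩
  | proj₀ hu ih | proj₁ hu ih =>
    refine ih hn.2 hf (.inl ⟨hn.1, ?_⟩) e
    rintro rfl
    rw [hasType_var_iff, e] at hu
    cases hu
  | efq _ ih => exact ih hn hf (.inr Form.belowPrimesIn_bot) e
  | par => exact hn.elim

theorem exists_fill {t : Tm} {n : ℕ} (hp : t.ParFree) (h : t.Applied n) (h' : t.occurs n) :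
    ∃ (𝒞 : Ctx) (u : Tm), t = 𝒞.fill (.app (.var (𝒞.depth + n)) u) ∧
      𝒞.occursRight n = false ∧ u.occurs (𝒞.depth + n) = false := by
  induction t generalizing n with
  | var m => exact absurd (by simpa [occurs] using h' : n = m).symm h
  | lam A u ih =>
    obtain ⟨𝒞, s, h₁, h₂, h₃⟩ := ih hp h h'
    have e : 𝒞.depth + (n + 1) = (Ctx.lam A 𝒞).depth + n := by rw [Ctx.depth_lam]; ring
    rw [e] at h₁ h₃
    exact ⟨.lam A 𝒞, s, congrArg _ h₁, h₂, h₃⟩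
  | app t u iht ihu =>
    by_cases hu : u.occurs n
    · obtain ⟨𝒞, s, h₁, h₂, h₃⟩ := ihu hp.2 h.2 hu
      exact ⟨.appR t 𝒞, s, congrArg _ h₁, h₂, h₃⟩
    · rcases h.1 with rfl | ht
      · exact ⟨.hole, u, by simp [Ctx.fill, Ctx.depth, Ctx.binders], rfl,
          by simpa [Ctx.depth, Ctx.binders] using hu⟩
      · obtain ⟨𝒞, s, h₁, h₂, h₃⟩ := iht hp.1 ht (by simpa [occurs, hu] using h')
        exact ⟨.appL 𝒞 u, s, congrArg (app · u) h₁, by simp [Ctx.occursRight, h₂, hu], h₃⟩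
  | pair t u iht ihu =>
    by_cases hu : u.occurs n
    · obtain ⟨𝒞, s, h₁, h₂, h₃⟩ := ihu hp.2 h.2 hu
      exact ⟨.pairR t 𝒞, s, congrArg _ h₁, h₂, h₃⟩
    · obtain ⟨𝒞, s, h₁, h₂, h₃⟩ := iht hp.1 h.1 (by simpa [occurs, hu] using h')
      exact ⟨.pairL 𝒞 u, s, congrArg (pair · u) h₁, by simp [Ctx.occursRight, h₂, hu], h₃⟩
  | proj i u ih =>
    obtain ⟨𝒞, s, h₁, h₂, h₃⟩ := ih hp h h'
    exact ⟨.proj i 𝒞, s, congrArg _ h₁, h₂, h₃⟩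
  | efq P u ih =>
    obtain ⟨𝒞, s, h₁, h₂, h₃⟩ := ih hp h h'
    exact ⟨.efq P 𝒞, s, congrArg _ h₁, h₂, h₃⟩
  | par => exact hp.elim

theorem exists_fillComm {t : Tm} (hp : t.ParFree) (h : t.Applied 0) (h' : t.occurs 0) :
    ∃ (𝒞 : Ctx) (u : Tm), t = 𝒞.fillComm u ∧ 𝒞.Rightmost u :=
  exists_fill hp h h'

end Tm

namespace Ctx

theorem mem_of_mem_binders {S : Set Form} {𝒞 : Ctx} {s : Tm} (h : (𝒞.fill s).BindersIn S)
    {A : Form} (hA : A ∈ 𝒞.binders) : A ∈ S := by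
  induction 𝒞 with
  | hole => cases hA
  | lam B 𝒞 ih =>
    rcases List.mem_append.1 hA with hA | hA
    · exact ih h.2 hA
    · exact List.mem_singleton.1 hA ▸ h.1
  | appL 𝒞 _ ih | pairL 𝒞 _ ih => exact ih h.1 hA
  | appR _ 𝒞 ih | pairR _ 𝒞 ih => exact ih h.2 hA
  | proj _ 𝒞 ih | efq _ 𝒞 ih => exact ih h hA

theorem parFree_fill {𝒞 : Ctx} {e s : Tm} (h : (𝒞.fill e).ParFree) (hs : s.ParFree) :
    (𝒞.fill s).ParFree := by
  induction 𝒞 with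
  | hole => exact hs
  | appL 𝒞 _ ih | pairL 𝒞 _ ih => exact ⟨ih h.1, h.2⟩
  | appR _ 𝒞 ih | pairR _ 𝒞 ih => exact ⟨h.1, ih h.2⟩
  | lam _ 𝒞 ih | proj _ 𝒞 ih | efq _ 𝒞 ih => exact ih h

theorem parFree_of_fill {𝒞 : Ctx} {e : Tm} (h : (𝒞.fill e).ParFree) : e.ParFree := by
  induction 𝒞 with
  | hole => exact h
  | appL 𝒞 _ ih | pairL 𝒞 _ ih => exact ih h.1
  | appR _ 𝒞 ih | pairR _ 𝒞 ih => exact ih h.2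
  | lam _ 𝒞 ih | proj _ 𝒞 ih | efq _ 𝒞 ih => exact ih h

end Ctx

/-! ### Occurrences removed by a communication -/

theorem liftRen_eq_liftRen_succ {ρ : ℕ → ℕ} {n : ℕ} (h : ∀ m, ρ m = ρ n → m = n) :
    ∀ m, liftRen ρ m = liftRen ρ (n + 1) → m = n + 1
  | m + 1, e => congrArg (· + 1) (h m (Nat.succ_injective e))

namespace Tm

/-- The number of free occurrences of a variable. -/
def count : ℕ → Tm → ℕ
  | n, var m => if n = m then 1 else 0
  | n, lam _ u => count (n + 1) u
  | n, app t u => count n t + count n u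
  | n, pair u t => count n u + count n t
  | n, proj _ u => count n u
  | n, efq _ u => count n u
  | n, par _ _ u v => count (n + 1) u + count (n + 1) v

theorem count_pos {t : Tm} {n : ℕ} : 0 < t.count n ↔ t.occurs n := by
  induction t generalizing n with
  | var m => by_cases h : n = m <;> simp [count, occurs, h]
  | _ => simp_all [count, occurs]

theorem count_rename {t : Tm} {ρ : ℕ → ℕ} {n : ℕ} (h : ∀ m, ρ m = ρ n → m = n) :
    (t.rename ρ).count (ρ n) = t.count n := by
  induction t generalizing ρ n with
  | var m => exact if_congr ⟨fun e => (h m e.symm).symm, congrArg ρ⟩ rfl rfl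
  | lam _ _ ih => exact ih (liftRen_eq_liftRen_succ h)
  | app _ _ iht ihu | pair _ _ iht ihu => exact congrArg₂ (· + ·) (iht h) (ihu h)
  | proj _ _ ih | efq _ _ ih => exact ih h
  | par _ _ _ _ ihu ihv =>
    exact congrArg₂ (· + ·) (ihu (liftRen_eq_liftRen_succ h)) (ihv (liftRen_eq_liftRen_succ h))

theorem occurs_rename_apply {t : Tm} {ρ : ℕ → ℕ} {n : ℕ} (h : ∀ m, ρ m = ρ n → m = n) :
    (t.rename ρ).occurs (ρ n) = t.occurs n := by
  rw [Bool.eq_iff_iff, ← count_pos, count_rename h, count_pos]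

end Tm

namespace Ctx

theorem occursRight_rename {𝒞 : Ctx} {ρ : ℕ → ℕ} {n : ℕ} (h : ∀ m, ρ m = ρ n → m = n) :
    (𝒞.rename ρ).occursRight (ρ n) = 𝒞.occursRight n := by
  induction 𝒞 generalizing ρ n with
  | hole => rfl
  | lam _ _ ih => exact ih (liftRen_eq_liftRen_succ h)
  | appL _ _ ih | pairL _ _ ih => exact congrArg₂ (· || ·) (ih h) (Tm.occurs_rename_apply h)
  | appR _ _ ih | pairR _ _ ih | proj _ _ ih | efq _ _ ih => exact ih h

/-- The path from the root to the hole consists of eliminations of the term in the hole: the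
contexts in which the hole is the head. -/
def Spine : Ctx → Prop
  | hole => True
  | appL 𝒞 _ => Spine 𝒞
  | proj _ 𝒞 => Spine 𝒞
  | _ => False

theorem Spine.occurs {𝒞 : Ctx} {n : ℕ} (h : 𝒞.Spine) : 𝒞.occurs n = 𝒞.occursRight n := by
  induction 𝒞 with
  | hole => rfl
  | appL 𝒞 t ih => rw [Ctx.occurs, occursRight, ih h]
  | proj _ 𝒞 ih => exact ih h
  | _ => exact h.elim

/-- On a spine, the rightmost occurrence of a variable is its only one. -/
theorem Spine.exists_nf_count_lt {𝒞 : Ctx} {e s : Tm} {n : ℕ} {Γ : List Form} {A : Form}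
    (h : 𝒞.Spine) (ht : HasType Γ (𝒞.fill s) A) (hp : (𝒞.fill s).ParFree)
    (hr : 𝒞.occursRight n = false) (hs : s.occurs (𝒞.depth + n) = false)
    (he : e.occurs (𝒞.depth + n)) :
    ∃ w, IntSteps (𝒞.fill s) w ∧ w.Nf ∧ w.count n < (𝒞.fill e).count n := by
  obtain ⟨w, hw, hw'⟩ := ht.wn hp
  have hn : ¬ w.occurs n := fun hn => by
    simpa [occurs_fill, h.occurs, hr, hs] using (hw.steps []).occurs hn
  refine ⟨w, hw, hw', ?_⟩
  calc w.count n = 0 := Nat.eq_zero_of_not_pos (mt Tm.count_pos.1 hn)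
    _ < (𝒞.fill e).count n := Tm.count_pos.2 (occurs_fill.2 (.inr he))

/-- A normal form of `𝒞[s]` can disturb the part of `𝒞` around the hole only along a spine, where
no occurrence of `n` is left; off the spine the head of `𝒞[e]` is preserved, hence the rest of the
term stays normal. -/
theorem exists_nf_count_lt {𝒞 : Ctx} {e s : Tm} {n : ℕ} {Γ : List Form} {A : Form}
    (ht : HasType Γ (𝒞.fill s) A) (hs : s.ParFree) (hn : (𝒞.fill e).Nf)
    (hr : 𝒞.occursRight n = false) (hns : s.occurs (𝒞.depth + n) = false)
    (he : e.occurs (𝒞.depth + n)) :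
    ∃ w, IntSteps (𝒞.fill s) w ∧ w.Nf ∧ w.count n < (𝒞.fill e).count n ∧
      (¬ 𝒞.Spine → (𝒞.fill e).Neutral → w.Neutral) := by
  by_cases hsp : 𝒞.Spine
  · obtain ⟨w, h₁, h₂, h₃⟩ := hsp.exists_nf_count_lt ht (parFree_fill hn.parFree hs) hr hns he
    exact ⟨w, h₁, h₂, h₃, absurd hsp⟩
  cases 𝒞 with
  | hole => exact absurd trivial hsp
  | lam B 𝒞 =>
    obtain ⟨C, ht, -⟩ := hasType_lam_iff.1 ht
    rw [depth_lam, Nat.add_right_comm] at hns he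
    obtain ⟨w, h₁, h₂, h₃, -⟩ := exists_nf_count_lt ht hs hn hr hns he
    exact ⟨.lam B w, h₁.lam, h₂, h₃, fun _ h => h⟩
  | appL 𝒞 t =>
    rw [occursRight, Bool.or_eq_false_iff] at hr
    obtain ⟨B, ht, -⟩ := hasType_app_iff.1 ht
    obtain ⟨w, h₁, h₂, h₃, h₄⟩ := exists_nf_count_lt ht hs hn.2.1 hr.1 hns he
    exact ⟨.app w t, h₁.app (.refl t), ⟨h₄ hsp hn.1, h₂, hn.2.2⟩, Nat.add_lt_add_right h₃ _,
      fun _ _ => trivial⟩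
  | appR t 𝒞 =>
    obtain ⟨B, -, ht⟩ := hasType_app_iff.1 ht
    obtain ⟨w, h₁, h₂, h₃, -⟩ := exists_nf_count_lt ht hs hn.2.2 hr hns he
    exact ⟨.app t w, .app (.refl t) h₁, ⟨hn.1, hn.2.1, h₂⟩, Nat.add_lt_add_left h₃ _,
      fun _ _ => trivial⟩
  | pairL 𝒞 t =>
    rw [occursRight, Bool.or_eq_false_iff] at hr
    obtain ⟨B, C, ⟨ht, -⟩, -⟩ := hasType_pair_iff.1 ht
    obtain ⟨w, h₁, h₂, h₃, -⟩ := exists_nf_count_lt ht hs hn.1 hr.1 hns he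
    exact ⟨.pair w t, h₁.pair (.refl t), ⟨h₂, hn.2⟩, Nat.add_lt_add_right h₃ _, fun _ h => h⟩
  | pairR t 𝒞 =>
    obtain ⟨B, C, ⟨-, ht⟩, -⟩ := hasType_pair_iff.1 ht
    obtain ⟨w, h₁, h₂, h₃, -⟩ := exists_nf_count_lt ht hs hn.2 hr hns he
    exact ⟨.pair t w, .pair (.refl t) h₁, ⟨hn.1, h₂⟩, Nat.add_lt_add_left h₃ _, fun _ h => h⟩
  | proj i 𝒞 =>
    obtain ⟨B, C, ht, -⟩ := hasType_proj_iff.1 ht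
    obtain ⟨w, h₁, h₂, h₃, h₄⟩ := exists_nf_count_lt ht hs hn.2 hr hns he
    exact ⟨.proj i w, h₁.proj, ⟨h₄ hsp hn.1, h₂⟩, h₃, fun _ _ => trivial⟩
  | efq P 𝒞 =>
    obtain ⟨ht, -⟩ := hasType_efq_iff.1 ht
    obtain ⟨w, h₁, h₂, h₃, -⟩ := exists_nf_count_lt ht hs hn hr hns he
    exact ⟨.efq P w, h₁.efq, h₂, h₃, fun _ _ => trivial⟩

end Ctx

/-! ### Reduction to a parallel form -/

namespace Tm

/-- The number of parallel operators: it bounds the number of times that another term constructor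
has to be permuted inside a parallel form. -/
def npar : Tm → ℕ
  | var _ => 0
  | lam _ u => npar u
  | app t u => npar t + npar u
  | pair u t => npar u + npar t
  | proj _ u => npar u
  | efq _ u => npar u
  | par _ _ u v => npar u + npar v + 1

theorem npar_rename {t : Tm} {ρ : ℕ → ℕ} : (t.rename ρ).npar = t.npar := by
  induction t generalizing ρ <;> simp_all only [rename, npar]

theorem npar_shift {t : Tm} : t.shift.npar = t.npar :=
  npar_rename

theorem parallelForm_par_iff {A B : Form} {u v : Tm} :
    (par A B u v).ParallelForm ↔ u.ParallelForm ∧ v.ParallelForm := by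
  refine ⟨fun h => ?_, fun h => .par h.1 h.2⟩
  cases h with
  | simple h => exact h.elim
  | par hu hv => exact ⟨hu, hv⟩

theorem parallelForm_rename {t : Tm} {ρ : ℕ → ℕ} :
    (t.rename ρ).ParallelForm ↔ t.ParallelForm := by
  induction t generalizing ρ with
  | par A B u v ihu ihv => rw [rename, parallelForm_par_iff, parallelForm_par_iff, ihu, ihv]
  | _ =>
    constructor <;> rintro ⟨h⟩
    exacts [.simple (parFree_rename.1 h), .simple (parFree_rename.2 h)]

theorem parallelForm_shift {t : Tm} : t.shift.ParallelForm ↔ t.ParallelForm :=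
  parallelForm_rename

end Tm

theorem exists_parallelForm_unary {f g : Tm → Tm}
    (hf : ∀ u, u.ParFree → (f u).ParFree)
    (hg : ∀ u, u.ParallelForm → (g u).ParallelForm) (hg' : ∀ u, (g u).npar = u.npar)
    (hfg : ∀ Γ A B u v, Step Γ (f (.par A B u v)) (.par A B (f (g u)) (f (g v))))
    {u : Tm} (hu : u.ParallelForm) (Γ : List Form) : ∃ s, Steps Γ (f u) s ∧ s.ParallelForm := by
  induction hk : u.npar using Nat.strong_induction_on generalizing u Γ with
  | _ k ih =>
  cases hu with
  | simple hu => exact ⟨_, .refl, .simple (hf _ hu)⟩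
  | @par A B u v hu hv =>
    rw [Tm.npar] at hk
    obtain ⟨s, hs, hs'⟩ := ih u.npar (by lia) (hg u hu) (.imp A B :: Γ) (hg' u)
    obtain ⟨r, hr, hr'⟩ := ih v.npar (by lia) (hg v hv) (.imp B A :: Γ) (hg' v)
    exact ⟨_, .head (hfg Γ A B u v) (hs.par hr), .par hs' hr'⟩

theorem exists_parallelForm_binary {f : Tm → Tm → Tm}
    (hf : ∀ u w, u.ParFree → w.ParFree → (f u w).ParFree)
    (hL : ∀ Γ A B u v w, Step Γ (f (.par A B u v) w) (.par A B (f u w.shift) (f v w.shift)))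
    (hR : ∀ Γ A B u v w, Step Γ (f w (.par A B u v)) (.par A B (f w.shift u) (f w.shift v)))
    {u w : Tm} (hu : u.ParallelForm) (hw : w.ParallelForm) (Γ : List Form) :
    ∃ s, Steps Γ (f u w) s ∧ s.ParallelForm := by
  induction hk : u.npar + w.npar using Nat.strong_induction_on generalizing u w Γ with
  | _ k ih =>
  cases hu with
  | @par A B u v hu hv =>
    rw [Tm.npar] at hk
    have hw' := Tm.parallelForm_shift.2 hw
    obtain ⟨s, hs, hs'⟩ := ih _ (by rw [Tm.npar_shift]; lia) hu hw' (.imp A B :: Γ) rfl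
    obtain ⟨r, hr, hr'⟩ := ih _ (by rw [Tm.npar_shift]; lia) hv hw' (.imp B A :: Γ) rfl
    exact ⟨_, .head (hL Γ A B u v w) (hs.par hr), .par hs' hr'⟩
  | simple hu =>
    cases hw with
    | simple hw => exact ⟨_, .refl, .simple (hf _ _ hu hw)⟩
    | @par A B v w hv hw =>
      rw [Tm.npar] at hk
      have hu' := Tm.parallelForm_shift.2 (.simple hu)
      obtain ⟨s, hs, hs'⟩ := ih _ (by rw [Tm.npar_shift]; lia) hu' hv (.imp A B :: Γ) rfl
      obtain ⟨r, hr, hr'⟩ := ih _ (by rw [Tm.npar_shift]; lia) hu' hw (.imp B A :: Γ) rfl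
      exact ⟨_, .head (hR Γ A B v w u) (hs.par hr), .par hs' hr'⟩

theorem exists_parallelForm_lam {A : Form} {u : Tm} (hu : u.ParallelForm) (Γ : List Form) :
    ∃ s, Steps Γ (.lam A u) s ∧ s.ParallelForm :=
  exists_parallelForm_unary (f := .lam A) (g := .rename swapRen) (fun _ h => h)
    (fun _ => Tm.parallelForm_rename.2) (fun _ => Tm.npar_rename)
    (fun Γ B C u v => .base (.perm (.lam Γ B C A u v))) hu Γ

theorem exists_parallelForm_app {t u : Tm} (ht : t.ParallelForm) (hu : u.ParallelForm)
    (Γ : List Form) : ∃ s, Steps Γ (.app t u) s ∧ s.ParallelForm :=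
  exists_parallelForm_binary (f := .app) (fun _ _ => .intro)
    (fun Γ A B u v w => .base (.perm (.appL Γ A B u v w)))
    (fun Γ A B u v w => .base (.perm (.appR Γ A B u v w))) ht hu Γ

theorem exists_parallelForm_pair {t u : Tm} (ht : t.ParallelForm) (hu : u.ParallelForm)
    (Γ : List Form) : ∃ s, Steps Γ (.pair t u) s ∧ s.ParallelForm :=
  exists_parallelForm_binary (f := .pair) (fun _ _ => .intro)
    (fun Γ A B u v w => .base (.perm (.pairL Γ A B u v w)))
    (fun Γ A B u v w => .base (.perm (.pairR Γ A B u v w))) ht hu Γ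

theorem exists_parallelForm_proj {i : Bool} {u : Tm} (hu : u.ParallelForm) (Γ : List Form) :
    ∃ s, Steps Γ (.proj i u) s ∧ s.ParallelForm :=
  exists_parallelForm_unary (f := .proj i) (g := id) (fun _ h => h) (fun _ h => h)
    (fun _ => rfl) (fun Γ A B u v => .base (.perm (.proj Γ A B i u v))) hu Γ

theorem exists_parallelForm_efq {P : ℕ} {u : Tm} (hu : u.ParallelForm) (Γ : List Form) :
    ∃ s, Steps Γ (.efq P u) s ∧ s.ParallelForm :=
  exists_parallelForm_unary (f := .efq P) (g := id) (fun _ h => h) (fun _ h => h)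
    (fun _ => rfl) (fun Γ A B u v => .base (.perm (.efq Γ A B P u v))) hu Γ

theorem exists_parallelForm (t : Tm) (Γ : List Form) : ∃ s, Steps Γ t s ∧ s.ParallelForm := by
  induction t generalizing Γ with
  | var n => exact ⟨_, .refl, .simple trivial⟩
  | lam A u ih =>
    obtain ⟨s, hs, hs'⟩ := ih (A :: Γ)
    exact (exists_parallelForm_lam hs' Γ).imp fun _ h => ⟨hs.lam.trans h.1, h.2⟩
  | app t u iht ihu =>
    obtain ⟨s, hs, hs'⟩ := iht Γ
    obtain ⟨r, hr, hr'⟩ := ihu Γ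
    exact (exists_parallelForm_app hs' hr' Γ).imp fun _ h => ⟨(hs.app hr).trans h.1, h.2⟩
  | pair t u iht ihu =>
    obtain ⟨s, hs, hs'⟩ := iht Γ
    obtain ⟨r, hr, hr'⟩ := ihu Γ
    exact (exists_parallelForm_pair hs' hr' Γ).imp fun _ h => ⟨(hs.pair hr).trans h.1, h.2⟩
  | proj i u ih =>
    obtain ⟨s, hs, hs'⟩ := ih Γ
    exact (exists_parallelForm_proj hs' Γ).imp fun _ h => ⟨hs.proj.trans h.1, h.2⟩
  | efq P u ih =>
    obtain ⟨s, hs, hs'⟩ := ih Γ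
    exact (exists_parallelForm_efq hs' Γ).imp fun _ h => ⟨hs.efq.trans h.1, h.2⟩
  | par A B u v ihu ihv =>
    obtain ⟨s, hs, hs'⟩ := ihu (.imp A B :: Γ)
    obtain ⟨r, hr, hr'⟩ := ihv (.imp B A :: Γ)
    exact ⟨_, hs.par hr, .par hs' hr'⟩

/-! ### Communication kinds and complexity -/

theorem Form.symbols_pos (A : Form) : 0 < A.symbols := by
  cases A <;> simp [symbols]

theorem commComplexity_pos {Γ : List Form} {t : Tm} {A B C : Form} :
    0 < commComplexity Γ t A B C ↔ ∃ P, (P ∈ B.primeFactors ∨ P ∈ C.primeFactors) ∧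
      ¬ P.ProperSubformula A ∧ ∀ D, IsFreeVarType Γ t D → ¬ P.StrongSubformula D := by
  simp only [commComplexity, Finset.lt_sup_iff, Finset.mem_filter, Finset.mem_union,
    Form.symbols_pos, and_true]

theorem posComm_of_not_primesIn {S : Set Form} {Γ : List Form} {A B C : Form} {u v : Tm}
    (ht : HasType Γ (.par B C u v) A) (hA : ∀ P, Form.ProperSubformula P A → P ∈ S)
    (hf : FreeStrongIn S Γ (.par B C u v)) (h : ¬ (B.PrimesIn S ∧ C.PrimesIn S)) :
    PosComm Γ B C u v := by
  refine ⟨A, ht, commComplexity_pos.2 ?_⟩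
  by_contra! hc
  have mem : ∀ P, P ∈ B.primeFactors ∨ P ∈ C.primeFactors → P ∈ S := fun P hP => by
    by_cases hPA : P.ProperSubformula A
    · exact hA P hPA
    · obtain ⟨D, ⟨n, hn, e⟩, hD⟩ := hc P hP hPA
      exact hf n D hn e P hD
  exact h ⟨fun P hP => mem P (.inl hP), fun P hP => mem P (.inr hP)⟩

theorem FreeStrongIn.of_par {S : Set Form} {Γ : List Form} {A B : Form} {u v : Tm}
    (h : FreeStrongIn S Γ (.par A B u v)) (hA : A.BelowPrimesIn S) (hB : B.BelowPrimesIn S) :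
    FreeStrongIn S (.imp A B :: Γ) u ∧ FreeStrongIn S (.imp B A :: Γ) v :=
  ⟨h.cons (fun _ h => by simp [Tm.occurs, h]) fun _ => Form.strongIn_imp hA hB,
    h.cons (fun _ h => by simp [Tm.occurs, h]) fun _ => Form.strongIn_imp hB hA⟩

namespace Tm

/-- Both components of each communication kind of the term satisfy `p`. -/
def KindsIn (p : Form → Prop) : Tm → Prop
  | var _ => True
  | lam _ u => KindsIn p u
  | app t u => KindsIn p t ∧ KindsIn p u
  | pair u t => KindsIn p u ∧ KindsIn p t
  | proj _ u => KindsIn p u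
  | efq _ u => KindsIn p u
  | par A B u v => (p A ∧ p B) ∧ KindsIn p u ∧ KindsIn p v

variable {p q : Form → Prop} {t : Tm}

theorem kindsIn_rename {ρ : ℕ → ℕ} : (t.rename ρ).KindsIn p ↔ t.KindsIn p := by
  induction t generalizing ρ <;> simp_all only [rename, KindsIn]

theorem KindsIn.mono (h : ∀ A, p A → q A) (ht : t.KindsIn p) : t.KindsIn q := by
  induction t with
  | var => trivial
  | lam _ _ ih | proj _ _ ih | efq _ _ ih => exact ih ht
  | app _ _ iht ihu | pair _ _ iht ihu => exact ht.imp iht ihu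
  | par A B _ _ ihu ihv => exact ht.imp (.imp (h A) (h B)) (.imp ihu ihv)

theorem ParFree.kindsIn (h : t.ParFree) : t.KindsIn p := by
  induction t with
  | var => trivial
  | lam _ _ ih | proj _ _ ih | efq _ _ ih => exact ih h
  | app _ _ iht ihu | pair _ _ iht ihu => exact h.imp iht ihu
  | par => exact h.elim

theorem exists_kindsIn_symbols_le (t : Tm) : ∃ c, t.KindsIn fun A => A.symbols ≤ c := by
  have mono : ∀ {c d : ℕ} {t : Tm}, c ≤ d → t.KindsIn (fun A => A.symbols ≤ c) →
      t.KindsIn fun A => A.symbols ≤ d := fun h => KindsIn.mono fun _ h' => h'.trans h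
  induction t with
  | var => exact ⟨0, trivial⟩
  | lam _ _ ih | proj _ _ ih | efq _ _ ih => exact ih
  | app _ _ iht ihu | pair _ _ iht ihu =>
    obtain ⟨c, hc⟩ := iht
    obtain ⟨d, hd⟩ := ihu
    exact ⟨max c d, mono (le_max_left c d) hc, mono (le_max_right c d) hd⟩
  | par A B _ _ ihu ihv =>
    obtain ⟨c, hc⟩ := ihu
    obtain ⟨d, hd⟩ := ihv
    exact ⟨max (max c d) (max A.symbols B.symbols), ⟨by simp, by simp⟩,
      mono (by simp) hc, mono (by simp) hd⟩

end Tm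

/-! ### Communication between normal simply typed terms -/

theorem parFree_tupleVars : ∀ y : List (Form × ℕ), (tupleVars y).ParFree
  | [] => trivial
  | [_] => trivial
  | _ :: q :: l => ⟨trivial, parFree_tupleVars (q :: l)⟩

theorem parFree_nthProj : ∀ {n i : ℕ} {t : Tm}, t.ParFree → (Tm.nthProj n i t).ParFree
  | 0, _, _, h => h
  | 1, _, _, h => h
  | _ + 2, 0, _, h => h
  | n + 2, i + 1, t, h => parFree_nthProj (n := n + 1) (i := i) (t := .proj true t) h

theorem parFree_migrate {k m : ℕ} {y z : List (Form × ℕ)} {u : Tm} (h : u.ParFree) :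
    (migrate k m y z u).ParFree := by
  refine Tm.parFree_subst h fun n => ?_
  split_ifs
  · exact parFree_nthProj ⟨trivial, parFree_tupleVars z⟩
  · trivial

theorem liftRen_succ_ne_one {m : ℕ} : liftRen Nat.succ m ≠ 1 := by
  cases m <;> simp [liftRen]

theorem exists_nf_fill_migrate {Γ : List Form} {A B C : Form} {𝒞 𝒟 : Ctx} {u v : Tm}
    (hC : HasType (.imp A B :: Γ) (𝒞.fillComm u) C)
    (hD : HasType (.imp B A :: Γ) (𝒟.fillComm v) C) (hu : u.ParFree)
    (hu' : u.occurs 𝒞.depth = false) (hv : (𝒟.fillComm v).Nf) (hv' : 𝒟.occursRight 0 = false) :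
    ∃ w, IntSteps ((𝒟.rename (liftRen Nat.succ)).fill
        (migrate 𝒞.depth 𝒟.depth (𝒞.boundVars u) (𝒟.boundVars v) u)) w ∧ w.Nf ∧
      w.count 0 < (𝒟.fillComm v).count 0 := by
  have inj : ∀ m, liftRen Nat.succ m = liftRen Nat.succ 0 → m = 0 := fun _ => liftRen_eq_zero.1
  have fill := 𝒟.rename_fill (.app (.var 𝒟.depth) v) (liftRen Nat.succ)
  have hb : (migrate 𝒞.depth 𝒟.depth (𝒞.boundVars u) (𝒟.boundVars v) u).occurs 𝒟.depth = false :=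
    Bool.eq_false_iff.2 fun h => by
      rcases occurs_migrate (n := 0) hu' h with ⟨h, -⟩ | ⟨j, h, -⟩ <;> cases h
  obtain ⟨w, h₁, h₂, h₃, -⟩ := Ctx.exists_nf_count_lt (n := 0)
    (e := (Tm.app (.var 𝒟.depth) v).rename (liftRen^[𝒟.depth] (liftRen Nat.succ)))
    (hasType_fill_migrate hC hD hu') (parFree_migrate hu) (fill ▸ Tm.nf_rename.2 hv)
    ((Ctx.occursRight_rename inj).trans hv') (by rwa [Ctx.depth_rename])
    (by simp [Ctx.depth_rename, Tm.rename, Tm.occurs, iterate_liftRen, liftRen])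
  exact ⟨w, h₁, h₂, h₃.trans_eq ((congrArg (Tm.count 0) fill.symm).trans (Tm.count_rename inj))⟩

theorem primesIn_conjTypes_boundVars {S : Set Form} (hS : Form.SubClosed S) {𝒞 : Ctx} {u : Tm}
    (hne : 𝒞.boundVars u ≠ []) (h : ∀ A ∈ 𝒞.binders, A ∈ S) :
    (conjTypes (𝒞.boundVars u)).PrimesIn S := by
  intro P hP
  obtain ⟨A, hA, hPA⟩ := Form.mem_primeFactors_conj (by simpa using hne) hP
  obtain ⟨p, hp, rfl⟩ := List.mem_map.1 hA
  exact hS.primesIn (h _ (List.mem_of_getElem? (Ctx.mem_boundVars.1 hp).1)) P hPA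

/-- The component `𝒟[u^{b⟨z⟩/y}] ∥ₐ 𝒞[a u]` of the result of a cross reduction of
`𝒞[a u] ∥ₐ 𝒟[a v]`, with `A, B` the communication kind of `a`. The other component is obtained by
exchanging the roles of the two sides. -/
def crossPart (A B : Form) (𝒞 𝒟 : Ctx) (u v : Tm) : Tm :=
  .par B A
    ((𝒟.rename (liftRen Nat.succ)).fill
      (migrate 𝒞.depth 𝒟.depth (𝒞.boundVars u) (𝒟.boundVars v) u))
    ((𝒞.fillComm u).rename (liftRen Nat.succ))

section CrossPart

variable {Γ : List Form} {A B C : Form} {𝒞 𝒟 : Ctx} {u v : Tm}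

theorem step_cross (hu : (𝒞.fillComm u).Nf) (hv : (𝒟.fillComm v).Nf) (hu' : 𝒞.Rightmost u)
    (hv' : 𝒟.Rightmost v) (h : PosComm Γ A B (𝒞.fillComm u) (𝒟.fillComm v)) :
    Step Γ (.par A B (𝒞.fillComm u) (𝒟.fillComm v))
      (.par (conjTypes (𝒟.boundVars v)) (conjTypes (𝒞.boundVars u))
        (crossPart A B 𝒞 𝒟 u v) (crossPart B A 𝒟 𝒞 v u)) :=
  .base (.cross (.cross Γ A B 𝒞 𝒟 u v _ _ hu.parFree hu.intNormal hv.parFree hv.intNormal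
    hu' hv' rfl rfl h))

theorem hasType_crossPart (hC : HasType (.imp A B :: Γ) (𝒞.fillComm u) C)
    (hD : HasType (.imp B A :: Γ) (𝒟.fillComm v) C) (hu : u.occurs 𝒞.depth = false) :
    HasType (.imp (conjTypes (𝒟.boundVars v)) (conjTypes (𝒞.boundVars u)) :: Γ)
      (crossPart A B 𝒞 𝒟 u v) C :=
  .par (hasType_fill_migrate hC hD hu) (hasType_rename_liftRen_succ_iff.2 hC)

theorem occurs_of_occurs_crossPart {n : ℕ} (hu : u.occurs 𝒞.depth = false)
    (h : (crossPart A B 𝒞 𝒟 u v).occurs (n + 1)) :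
    (Tm.par A B (𝒞.fillComm u) (𝒟.fillComm v)).occurs n := by
  simp only [crossPart, Tm.occurs, occurs_rename_liftRen_succ, Bool.or_eq_true] at h ⊢
  exact h.elim (occurs_fill_migrate hu) .inl

theorem boundVars_ne_nil_of_occurs_crossPart (hu : u.occurs 𝒞.depth = false)
    (h : (crossPart A B 𝒞 𝒟 u v).occurs 0) : 𝒞.boundVars u ≠ [] := by
  rw [crossPart, Tm.occurs, Bool.or_eq_true, Ctx.occurs_fill, Ctx.occurs_rename,
    Tm.occurs_rename, Ctx.depth_rename] at h
  rcases h with (⟨m, -, h⟩ | h) | ⟨m, -, h⟩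
  · exact absurd h liftRen_succ_ne_one
  · rcases occurs_migrate hu h with ⟨-, h⟩ | ⟨j, hj, -⟩
    · exact h
    · cases hj
  · exact absurd h liftRen_succ_ne_one

theorem exists_nf_crossPart (hC : HasType (.imp A B :: Γ) (𝒞.fillComm u) C)
    (hD : HasType (.imp B A :: Γ) (𝒟.fillComm v) C) (hu : (𝒞.fillComm u).Nf)
    (hv : (𝒟.fillComm v).Nf) (hu' : u.occurs 𝒞.depth = false) (hv' : 𝒟.occursRight 0 = false)
    (Δ : List Form) :
    ∃ s r, Steps Δ (crossPart A B 𝒞 𝒟 u v) (.par B A s r) ∧ s.Nf ∧ r.Nf ∧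
      s.count 0 + r.count 0 < (𝒞.fillComm u).count 0 + (𝒟.fillComm v).count 0 := by
  have hp : u.ParFree := (Ctx.parFree_of_fill hu.parFree).2
  obtain ⟨w, hw, hwn, hwc⟩ := exists_nf_fill_migrate hC hD hp hu' hv hv'
  refine ⟨w, _, .par (hw.steps _) .refl, hwn, Tm.nf_rename.2 hu, ?_⟩
  have hc : ((𝒞.fillComm u).rename (liftRen Nat.succ)).count 0 = (𝒞.fillComm u).count 0 :=
    Tm.count_rename (ρ := liftRen Nat.succ) (n := 0) fun _ => liftRen_eq_zero.1
  lia

end CrossPart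

/-! ### Lowering the communication kinds -/

/-- `t` reduces to a parallel form whose communication kinds have all their prime factors in
`S`. -/
def Lowerable (S : Set Form) (Γ : List Form) (t : Tm) : Prop :=
  ∃ s, Steps Γ t s ∧ s.ParallelForm ∧ s.KindsIn (Form.PrimesIn S)

namespace Lowerable

variable {S : Set Form} {Γ : List Form} {A B : Form} {t t' u v : Tm}

theorem of_parFree (h : t.ParFree) : Lowerable S Γ t :=
  ⟨t, .refl, .simple h, h.kindsIn⟩

theorem head (h : Steps Γ t t') : Lowerable S Γ t' → Lowerable S Γ t
  | ⟨s, hs, hs'⟩ => ⟨s, h.trans hs, hs'⟩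

theorem par (hA : A.PrimesIn S) (hB : B.PrimesIn S) :
    Lowerable S (.imp A B :: Γ) u → Lowerable S (.imp B A :: Γ) v → Lowerable S Γ (.par A B u v)
  | ⟨_, hs, hs', hs''⟩, ⟨_, hr, hr', hr''⟩ => ⟨_, hs.par hr, .par hs' hr', ⟨hA, hB⟩, hs'', hr''⟩

theorem par_of_not_occurs_left (h : Lowerable S (.imp A B :: Γ) u) (hu : ¬ u.occurs 0) :
    Lowerable S Γ (.par A B u v) := by
  obtain ⟨s, hs, hs', hs''⟩ := h
  obtain ⟨s, rfl⟩ := Tm.exists_eq_shift (Bool.eq_false_iff.2 (mt hs.occurs hu))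
  exact ⟨s, (hs.par .refl).tail (.base (.cross (.left _ _ _ _ _))), Tm.parallelForm_rename.1 hs',
    Tm.kindsIn_rename.1 hs''⟩

theorem par_of_not_occurs_right (h : Lowerable S (.imp B A :: Γ) v) (hv : ¬ v.occurs 0) :
    Lowerable S Γ (.par A B u v) := by
  obtain ⟨s, hs, hs', hs''⟩ := h
  obtain ⟨s, rfl⟩ := Tm.exists_eq_shift (Bool.eq_false_iff.2 (mt hs.occurs hv))
  exact ⟨s, (CompatStar.par .refl hs).tail (.base (.cross (.right _ _ _ _ _))),
    Tm.parallelForm_rename.1 hs', Tm.kindsIn_rename.1 hs''⟩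

/-- If the communication variable is missing on one side, that side alone has to be lowered. -/
theorem par_of_occurs (hu : (u.occurs 0 → v.occurs 0) → Lowerable S (.imp A B :: Γ) u)
    (hv : (v.occurs 0 → u.occurs 0) → Lowerable S (.imp B A :: Γ) v)
    (h : u.occurs 0 → v.occurs 0 → A.PrimesIn S ∧ B.PrimesIn S) : Lowerable S Γ (.par A B u v) := by
  by_cases hu0 : u.occurs 0
  · by_cases hv0 : v.occurs 0
    · exact par (h hu0 hv0).1 (h hu0 hv0).2 (hu fun _ => hv0) (hv fun _ => hu0)
    · exact par_of_not_occurs_right (hv fun h => absurd h hv0) hv0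
  · exact par_of_not_occurs_left (hu fun h => absurd h hu0) hu0

end Lowerable

section

variable {S : Set Form} {C : Form}

theorem exists_fillComm_of_nf {Γ : List Form} {A B : Form} {t : Tm} (hS : Form.SubClosed S)
    (hC : C.BelowPrimesIn S) (hAB : ¬ (A ∈ S ∧ B ∈ S)) (ht : HasType (.imp A B :: Γ) t C)
    (hn : t.Nf) (hf : FreeStrongIn S (.imp A B :: Γ) t) (h0 : t.occurs 0) :
    ∃ (𝒞 : Ctx) (u : Tm), t = 𝒞.fillComm u ∧ 𝒞.Rightmost u ∧ ∀ D ∈ 𝒞.binders, D ∈ S := by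
  obtain ⟨𝒞, u, rfl, hu⟩ :=
    Tm.exists_fillComm hn.parFree (hn.applied hS ht hf (.inr hC) (n := 0) rfl hAB) h0
  exact ⟨𝒞, u, rfl, hu, fun _ => Ctx.mem_of_mem_binders (hn.bindersIn hS ht hf (.inr hC))⟩

/-- Cross reductions terminate: in each component of the result, once it is normalized, the
communication variable has fewer occurrences. The kind of the new variable consists of types of
bound variables, which belong to `S` by the subformula property. -/
theorem lowerable_par_of_nf (hS : Form.SubClosed S) (hC : ∀ P, Form.ProperSubformula P C → P ∈ S)
    {Γ : List Form} {A B : Form} {u v : Tm} (hA : A.BelowPrimesIn S) (hB : B.BelowPrimesIn S)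
    (hAB : ¬ (A.PrimesIn S ∧ B.PrimesIn S)) (ht : HasType Γ (.par A B u v) C) (hu : u.Nf)
    (hv : v.Nf) (hf : FreeStrongIn S Γ (.par A B u v)) : Lowerable S Γ (.par A B u v) := by
  induction hk : u.count 0 + v.count 0 using Nat.strong_induction_on generalizing Γ A B u v with
  | _ k ih =>
  by_cases h0 : u.occurs 0 ∧ v.occurs 0
  swap
  · exact .par_of_occurs (fun _ => .of_parFree hu.parFree) (fun _ => .of_parFree hv.parFree)
      fun hu0 hv0 => absurd ⟨hu0, hv0⟩ h0
  have hpos := posComm_of_not_primesIn ht hC hf hAB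
  have hC' := Form.belowPrimesIn_of_properSubformula hC
  have hAB' : ¬ (A ∈ S ∧ B ∈ S) := fun h => hAB (h.imp hS.primesIn hS.primesIn)
  obtain ⟨htu, htv⟩ := hasType_par_iff.1 ht
  obtain ⟨hfu, hfv⟩ := hf.of_par hA hB
  obtain ⟨𝒞, u, rfl, hu', h𝒞⟩ := exists_fillComm_of_nf hS hC' hAB' htu hu hfu h0.1
  obtain ⟨𝒟, v, rfl, hv', h𝒟⟩ :=
    exists_fillComm_of_nf hS hC' (mt And.symm hAB') htv hv hfv h0.2
  have hy (h : (crossPart A B 𝒞 𝒟 u v).occurs 0) := primesIn_conjTypes_boundVars hS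
    (boundVars_ne_nil_of_occurs_crossPart hu'.2 h) h𝒞
  have hz (h : (crossPart B A 𝒟 𝒞 v u).occurs 0) := primesIn_conjTypes_boundVars hS
    (boundVars_ne_nil_of_occurs_crossPart hv'.2 h) h𝒟
  refine .head (.single (step_cross hu hv hu' hv' hpos))
    (.par_of_occurs (fun h => ?_) (fun h => ?_) fun h h' => ⟨hz h', hy h⟩)
  · obtain ⟨s, r, hs, hsn, hrn, hc⟩ := exists_nf_crossPart htu htv hu hv hu'.2 hv'.1 _
    have hf' := hf.cons (fun _ => occurs_of_occurs_crossPart hu'.2) fun h' =>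
      Form.strongIn_imp (hS.belowPrimesIn (hz (h h'))) (hS.belowPrimesIn (hy h'))
    exact .head hs (ih _ (by lia) hB hA (mt And.symm hAB)
      (hs.hasType (hasType_crossPart htu htv hu'.2)) hsn hrn (hf'.mono fun _ => hs.occurs) rfl)
  · obtain ⟨s, r, hs, hsn, hrn, hc⟩ := exists_nf_crossPart htv htu hv hu hv'.2 hu'.1 _
    have hf' := hf.cons
      (fun _ h => (by simpa [Tm.occurs, or_comm] using occurs_of_occurs_crossPart hv'.2 h))
      fun h' => Form.strongIn_imp (hS.belowPrimesIn (hy (h h'))) (hS.belowPrimesIn (hz h'))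
    exact .head hs (ih _ (by lia) hA hB hAB
      (hs.hasType (hasType_crossPart htv htu hv'.2)) hsn hrn (hf'.mono fun _ => hs.occurs) rfl)

theorem lowerable_par_of_parFree (hS : Form.SubClosed S)
    (hC : ∀ P, Form.ProperSubformula P C → P ∈ S) {Γ : List Form} {A B : Form} {u v : Tm}
    (hA : A.BelowPrimesIn S) (hB : B.BelowPrimesIn S) (hAB : ¬ (A.PrimesIn S ∧ B.PrimesIn S))
    (ht : HasType Γ (.par A B u v) C) (hf : FreeStrongIn S Γ (.par A B u v)) (hu : u.ParFree)
    (hv : v.ParFree) : Lowerable S Γ (.par A B u v) := by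
  obtain ⟨htu, htv⟩ := hasType_par_iff.1 ht
  obtain ⟨u', hu', hun⟩ := htu.wn hu
  obtain ⟨v', hv', hvn⟩ := htv.wn hv
  have hs : Steps Γ (.par A B u v) (.par A B u' v') := (hu'.steps _).par (hv'.steps _)
  exact .head hs (lowerable_par_of_nf hS hC hA hB hAB (hs.hasType ht) hun hvn
    (hf.mono fun _ => hs.occurs))

theorem lowerable_par (hS : Form.SubClosed S) (hC : ∀ P, Form.ProperSubformula P C → P ∈ S)
    {Γ : List Form} {A B : Form} {u v : Tm} (hA : A.BelowPrimesIn S) (hB : B.BelowPrimesIn S)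
    (hAB : ¬ (A.PrimesIn S ∧ B.PrimesIn S)) (ht : HasType Γ (.par A B u v) C)
    (hf : FreeStrongIn S Γ (.par A B u v)) (hu : u.ParallelForm) (hv : v.ParallelForm)
    (hku : u.KindsIn (Form.PrimesIn S)) (hkv : v.KindsIn (Form.PrimesIn S)) :
    Lowerable S Γ (.par A B u v) := by
  induction hk : u.npar + v.npar using Nat.strong_induction_on generalizing Γ u v with
  | _ k ih =>
  have hpos := posComm_of_not_primesIn ht hC hf hAB
  cases hu with
  | @par D E u₁ u₂ hu₁ hu₂ =>
    have hs : Steps Γ _ _ := .single (.base (.perm (.parL Γ D E A B u₁ u₂ v hpos)))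
    obtain ⟨⟨hD, hE⟩, hku₁, hku₂⟩ := hku
    obtain ⟨ht₁, ht₂⟩ := hasType_par_iff.1 (hs.hasType ht)
    obtain ⟨hf₁, hf₂⟩ := (hf.mono fun _ => hs.occurs).of_par (hS.belowPrimesIn hD)
      (hS.belowPrimesIn hE)
    rw [Tm.npar] at hk
    refine .head hs (.par hD hE (ih _ ?_ ht₁ hf₁ ?_ ?_ ?_ ?_ rfl) (ih _ ?_ ht₂ hf₂ ?_ ?_ ?_ ?_ rfl))
    all_goals
      first | rwa [Tm.parallelForm_rename] | rwa [Tm.kindsIn_rename]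
            | simp only [Tm.npar_rename]; lia
  | simple hu =>
  cases hv with
  | @par D E v₁ v₂ hv₁ hv₂ =>
    have hs : Steps Γ _ _ := .single (.base (.perm (.parR Γ D E A B v₁ v₂ u hpos)))
    obtain ⟨⟨hD, hE⟩, hkv₁, hkv₂⟩ := hkv
    obtain ⟨ht₁, ht₂⟩ := hasType_par_iff.1 (hs.hasType ht)
    obtain ⟨hf₁, hf₂⟩ := (hf.mono fun _ => hs.occurs).of_par (hS.belowPrimesIn hD)
      (hS.belowPrimesIn hE)
    rw [Tm.npar] at hk
    have hu' := Tm.ParallelForm.simple hu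
    refine .head hs (.par hD hE (ih _ ?_ ht₁ hf₁ ?_ ?_ ?_ ?_ rfl) (ih _ ?_ ht₂ hf₂ ?_ ?_ ?_ ?_ rfl))
    all_goals
      first | rwa [Tm.parallelForm_rename] | rwa [Tm.kindsIn_rename]
            | simp only [Tm.npar_rename]; lia
  | simple hv =>
    exact lowerable_par_of_parFree hS hC hA hB hAB ht hf hu hv

theorem lowerable_of_kindsIn (hS : Form.SubClosed S)
    (hC : ∀ P, Form.ProperSubformula P C → P ∈ S) {Γ : List Form} {t : Tm} (h : t.ParallelForm)
    (ht : HasType Γ t C) (hf : FreeStrongIn S Γ t) (hk : t.KindsIn (Form.BelowPrimesIn S)) :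
    Lowerable S Γ t := by
  induction h generalizing Γ with
  | simple h => exact .of_parFree h
  | @par A B u v _ _ ihu ihv =>
    obtain ⟨⟨hA, hB⟩, hku, hkv⟩ := hk
    obtain ⟨htu, htv⟩ := hasType_par_iff.1 ht
    obtain ⟨hfu, hfv⟩ := hf.of_par hA hB
    have hu := ihu htu hfu hku
    have hv := ihv htv hfv hkv
    by_cases hAB : A.PrimesIn S ∧ B.PrimesIn S
    · exact .par hAB.1 hAB.2 hu hv
    · obtain ⟨u', hu, hu', hku'⟩ := hu
      obtain ⟨v', hv, hv', hkv'⟩ := hv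
      have hs : Steps Γ (.par A B u v) (.par A B u' v') := hu.par hv
      exact .head hs (lowerable_par hS hC hA hB hAB (hs.hasType ht) (hf.mono fun _ => hs.occurs)
        hu' hv' hku' hkv')

theorem lowerable_of_kindsIn_symbols_lt (hS : Form.SubClosed S)
    (hC : ∀ P, Form.ProperSubformula P C → P ∈ S) {Γ : List Form} {t : Tm} {c : ℕ}
    (h : t.ParallelForm) (ht : HasType Γ t C) (hf : FreeStrongIn S Γ t)
    (hk : t.KindsIn (Form.BelowPrimesIn (S ∪ {P | P.symbols < c}))) : Lowerable S Γ t := by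
  induction c generalizing t with
  | zero => exact lowerable_of_kindsIn hS hC h ht hf (by simpa using hk)
  | succ c ih =>
    have hS' : Form.SubClosed (S ∪ {P | P.symbols < c + 1}) := by
      rintro P Q (h | h) hP
      · exact .inl (hS h hP)
      · exact .inr ((Form.symbols_le_of_mem hP).trans_lt h)
    obtain ⟨s, h₁, h₂, h₃⟩ := lowerable_of_kindsIn hS' (fun P hP => .inl (hC P hP)) h ht
      (fun n F hn e P hP => .inl (hf n F hn e P hP)) hk
    refine .head h₁ (ih h₂ (h₁.hasType ht) (hf.mono fun _ => h₁.occurs)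
      (h₃.mono fun A hA Q hQ P hP => ?_))
    exact (hA Q hQ).imp (hS · hP.1) fun h => hP.symbols_lt.trans_le (Nat.le_of_lt_succ h)

theorem lowerable (hS : Form.SubClosed S) (hC : ∀ P, Form.ProperSubformula P C → P ∈ S)
    {Γ : List Form} {t : Tm} (h : t.ParallelForm) (ht : HasType Γ t C)
    (hf : FreeStrongIn S Γ t) : Lowerable S Γ t := by
  obtain ⟨c, hc⟩ := t.exists_kindsIn_symbols_le
  refine lowerable_of_kindsIn_symbols_lt (c := c) hS hC h ht hf
    (hc.mono fun A hA Q hQ P hP => .inr ?_)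
  exact (hP.trans_mem (Form.mem_subformulas_of_mem_primeFactors hQ)).symbols_lt.trans_le hA

end

/-! ### Normal parallel forms -/

/-- Parallel forms of type `A` in which the simply typed components are normal, communication
variables occur on both sides and communication complexities are zero. -/
inductive NormalForm (A : Form) : List Form → Tm → Prop where
  | simple {Γ : List Form} {t : Tm} : t.Nf → NormalForm A Γ t
  | par {Γ : List Form} {B C : Form} {u v : Tm} :
      NormalForm A (.imp B C :: Γ) u → NormalForm A (.imp C B :: Γ) v →
      u.occurs 0 → v.occurs 0 → commComplexity Γ (.par B C u v) A B C = 0 →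
      NormalForm A Γ (.par B C u v)

theorem NormalForm.parallelForm {A : Form} {Γ : List Form} {t : Tm} (h : NormalForm A Γ t) :
    t.ParallelForm := by
  induction h with
  | simple h => exact .simple h.parFree
  | par _ _ _ _ _ ihu ihv => exact .par ihu ihv

theorem NormalForm.isNormal {A : Form} {Γ : List Form} {t : Tm} (h : NormalForm A Γ t)
    (ht : HasType Γ t A) : IsNormal Γ t := by
  induction h with
  | simple h => exact (intNormal_iff_isNormal h.parFree _).1 h.intNormal
  | @par Γ B C u v _ _ hu hv hc ihu ihv =>
    have hpos : ¬ PosComm Γ B C u v := by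
      rintro ⟨A', ht', h⟩
      rw [ht'.unique ht, hc] at h
      exact lt_irrefl _ h
    obtain ⟨htu, htv⟩ := hasType_par_iff.1 ht
    intro t' hs
    cases hs with
    | base h =>
      cases h with
      | int h => cases h
      | perm h => cases h <;> exact hpos ‹_›
      | cross h =>
        cases h with
        | left => simp [Tm.occurs_shift_zero] at hu
        | right => simp [Tm.occurs_shift_zero] at hv
        | cross => exact hpos ‹_›
    | parL h => exact ihu htu _ h
    | parR h => exact ihv htv _ h

theorem isFreeVarType_rename {Γ Δ : List Form} {t : Tm} {ρ : ℕ → ℕ}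
    (h : ∀ n, t.occurs n → Δ[ρ n]? = Γ[n]?) (D : Form) :
    IsFreeVarType Δ (t.rename ρ) D ↔ IsFreeVarType Γ t D := by
  constructor
  · rintro ⟨n, hn, e⟩
    obtain ⟨m, hm, rfl⟩ := Tm.occurs_rename.1 hn
    exact ⟨m, hm, (h m hm).symm.trans e⟩
  · rintro ⟨n, hn, e⟩
    exact ⟨ρ n, Tm.occurs_rename.2 ⟨n, hn, rfl⟩, (h n hn).trans e⟩

theorem commComplexity_rename {Γ Δ : List Form} {t : Tm} {ρ : ℕ → ℕ}
    (h : ∀ n, t.occurs n → Δ[ρ n]? = Γ[n]?) (A B C : Form) :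
    commComplexity Δ (t.rename ρ) A B C = commComplexity Γ t A B C := by
  rw [commComplexity, commComplexity, funext fun D => propext (isFreeVarType_rename h D)]

theorem Tm.occurs_rename_liftRen_zero {t : Tm} {ρ : ℕ → ℕ} :
    (t.rename (liftRen ρ)).occurs 0 ↔ t.occurs 0 := by
  simp [occurs_rename, liftRen_eq_zero]

theorem NormalForm.of_rename {A : Form} {Γ Δ : List Form} {t : Tm} {ρ : ℕ → ℕ}
    (H : NormalForm A Δ (t.rename ρ)) (h : ∀ n, t.occurs n → Δ[ρ n]? = Γ[n]?) :
    NormalForm A Γ t := by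
  induction t generalizing Γ Δ ρ with
  | par B C u v ihu ihv =>
    have hc := commComplexity_rename h A B C
    rw [Tm.rename] at H hc
    cases H with
    | simple H => exact H.elim
    | par hu hv hu0 hv0 h0 =>
      simp only [Tm.occurs, Bool.or_eq_true, or_imp, forall_and] at h
      exact .par (ihu hu (getElem?_cons_liftRen h.1 _)) (ihv hv (getElem?_cons_liftRen h.2 _))
        (Tm.occurs_rename_liftRen_zero.1 hu0) (Tm.occurs_rename_liftRen_zero.1 hv0)
        (hc.symm.trans h0)
  | _ => cases H with | simple H => exact .simple (Tm.nf_rename.1 H)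

theorem NormalForm.of_shift {A B : Form} {Γ : List Form} {t : Tm}
    (h : NormalForm A (B :: Γ) t.shift) : NormalForm A Γ t :=
  h.of_rename fun n _ => by simp

/-! ### Normalization -/

section

variable {E : Finset Form} {A B C : Form} {Γ : List Form} {t u v : Tm}

theorem exists_normalForm_par_or_commComplexity_pos (hu : NormalForm A (.imp B C :: Γ) u)
    (hv : NormalForm A (.imp C B :: Γ) v) :
    (∃ s, Steps Γ (.par B C u v) s ∧ NormalForm A Γ s) ∨
      0 < commComplexity Γ (.par B C u v) A B C := by
  cases hu0 : u.occurs 0 with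
  | false =>
    obtain ⟨s, rfl⟩ := Tm.exists_eq_shift hu0
    exact .inl ⟨s, .single (.base (.cross (.left _ _ _ _ _))), hu.of_shift⟩
  | true =>
  cases hv0 : v.occurs 0 with
  | false =>
    obtain ⟨s, rfl⟩ := Tm.exists_eq_shift hv0
    exact .inl ⟨s, .single (.base (.cross (.right _ _ _ _ _))), hv.of_shift⟩
  | true =>
    exact (Nat.eq_zero_or_pos _).imp (fun hc => ⟨_, .refl, .par hu hv hu0 hv0 hc⟩) id

/-- The prime factor witnessing a positive complexity is dispensable: it is neither a proper
subformula of the type nor a strong subformula of the type of a free variable. -/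
theorem exists_ssubset_of_commComplexity_pos (hE : Form.SubClosed (E : Set Form))
    (hA : ∀ P, Form.ProperSubformula P A → P ∈ E) (hf : FreeStrongIn E Γ t)
    (hB : B.PrimesIn E) (hC : C.PrimesIn E) (hc : 0 < commComplexity Γ t A B C) :
    ∃ E' ⊂ E, Form.SubClosed (E' : Set Form) ∧ (∀ P, Form.ProperSubformula P A → P ∈ E') ∧
      FreeStrongIn E' Γ t := by
  classical
  obtain ⟨Q, hQ, hQA, hQf⟩ := commComplexity_pos.1 hc
  refine ⟨E.filter fun P => P.ProperSubformula A ∨ ∃ D, IsFreeVarType Γ t D ∧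
    P.StrongSubformula D, Finset.filter_ssubset.2 ⟨Q, hQ.elim (hB Q) (hC Q), ?_⟩, ?_,
    fun P hP => Finset.mem_filter.2 ⟨hA P hP, .inl hP⟩,
    fun n F hn e P hP => Finset.mem_filter.2 ⟨hf n F hn e P hP, .inr ⟨F, ⟨n, hn, e⟩, hP⟩⟩⟩
  · rintro (h | ⟨D, h, h'⟩)
    · exact hQA h
    · exact hQf D h h'
  · intro P R hR hP
    rw [Finset.mem_coe, Finset.mem_filter] at hR ⊢
    exact ⟨hE hR.1 hP, hR.2.imp (Form.properSubformula_of_mem hP)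
      fun ⟨D, h, h'⟩ => ⟨D, h, Form.strongSubformula_of_mem hP h'⟩⟩

theorem exists_normalForm (hE : Form.SubClosed (E : Set Form))
    (hA : ∀ P, Form.ProperSubformula P A → P ∈ E) (h : t.ParallelForm) (ht : HasType Γ t A)
    (hf : FreeStrongIn E Γ t) : ∃ s, Steps Γ t s ∧ NormalForm A Γ s := by
  induction E using Finset.strongInduction generalizing Γ t with
  | H E ih =>
  suffices key : ∀ {s}, s.ParallelForm → ∀ {Γ}, HasType Γ s A → FreeStrongIn E Γ s →
      s.KindsIn (Form.PrimesIn E) → ∃ r, Steps Γ s r ∧ NormalForm A Γ r by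
    obtain ⟨s, hs, hs', hk⟩ := lowerable hE hA h ht hf
    obtain ⟨r, hr, hr'⟩ := key hs' (hs.hasType ht) (hf.mono fun _ => hs.occurs) hk
    exact ⟨r, hs.trans hr, hr'⟩
  clear! t
  intro t h Γ ht hf hk
  induction h generalizing Γ with
  | simple h =>
    obtain ⟨s, hs, hs'⟩ := ht.wn h
    exact ⟨s, hs.steps Γ, .simple hs'⟩
  | @par B C u v _ _ ihu ihv =>
    obtain ⟨⟨hB, hC⟩, hku, hkv⟩ := hk
    obtain ⟨htu, htv⟩ := hasType_par_iff.1 ht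
    obtain ⟨hfu, hfv⟩ := hf.of_par (hE.belowPrimesIn hB) (hE.belowPrimesIn hC)
    obtain ⟨u', hu, hun⟩ := ihu htu hfu hku
    obtain ⟨v', hv, hvn⟩ := ihv htv hfv hkv
    have hs : Steps Γ (.par B C u v) (.par B C u' v') := hu.par hv
    obtain ⟨r, hr, hr'⟩ | hc := exists_normalForm_par_or_commComplexity_pos hun hvn
    · exact ⟨r, hs.trans hr, hr'⟩
    · obtain ⟨E', hEE', hE', hA', hf'⟩ := exists_ssubset_of_commComplexity_pos hE hA
        (hf.mono fun _ => hs.occurs) hB hC hc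
      obtain ⟨r, hr, hr'⟩ := ih E' hEE' hE' hA' (.par hun.parallelForm hvn.parallelForm)
        (hs.hasType ht) hf'
      exact ⟨r, hs.trans hr, hr'⟩

theorem HasType.exists_normalForm (ht : HasType Γ t A) :
    ∃ s, Steps Γ t s ∧ NormalForm A Γ s := by
  obtain ⟨s, hs, hs'⟩ := exists_parallelForm t Γ
  have hE : Form.SubClosed ((A :: Γ).toFinset.biUnion Form.subformulas : Set Form) := by
    intro P Q hQ hP
    obtain ⟨F, hF, hQF⟩ := Finset.mem_biUnion.1 (Finset.mem_coe.1 hQ)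
    exact Finset.mem_biUnion.2 ⟨F, hF, Form.subformulas_trans hP hQF⟩
  obtain ⟨r, hr, hr'⟩ := LambdaG.exists_normalForm (A := A)
    (E := (A :: Γ).toFinset.biUnion Form.subformulas) hE
    (fun P hP => Finset.mem_biUnion.2 ⟨A, by simp, hP.1⟩) hs' (hs.hasType ht)
    (fun n F _ e P hP => Finset.mem_biUnion.2
      ⟨F, by simp [List.mem_of_getElem? e], hP.properSubformula.1⟩)
  exact ⟨r, hs.trans hr, hr'⟩

end

end LambdaG

theorem mainTheorem1 (Γ : List LambdaG.Form) (t : LambdaG.Tm) (A : LambdaG.Form)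
    (ht : LambdaG.HasType Γ t A) :
    ∃ t' : LambdaG.Tm,
      Relation.ReflTransGen (LambdaG.Step Γ) t t' ∧
      LambdaG.HasType Γ t' A ∧
      (∀ n : ℕ, t'.occurs n = true → t.occurs n = true) ∧
      t'.ParallelForm ∧
      LambdaG.IsNormal Γ t' := by
  obtain ⟨s, h, hs⟩ := ht.exists_normalForm
  have hsA := LambdaG.Steps.hasType h ht
  exact ⟨s, h, hsA, fun _ => LambdaG.Steps.occurs h, hs.parallelForm, hs.isNormal hsA⟩
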